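/- Let $\gamma=N(0,1)$ be the standard Gaussian distribution on $\mathbb{R}$, let $x_+=\max(x,0)$, and let $\tau$ be a standard Rayleigh random variable, with density $ye^{-y^2/2}$ on $y>0$. The limiting radial momentum process $R^F=(R^F_t)_{t\ge0}$ is the piecewise deterministic Markov process on $\mathbb{R}$ that moves at unit speed ($x\mapsto x+s$) between jumps, jumps at rate $x_+$ when in the state $x$, and after each jump restarts from an independent copy of $-\tau$; its (extended) generator is $$L^Ff(x)=f'(x)+x_+\bigl(\mathbb{E}[f(-\tau)]-f(x)\bigr).$$ Let $P^t(x,\cdot)$ be the law of $R^F_t$ given $R^F_0=x$. Then $(P^t)_{t\ge0}$ is a Markov semigroup ($P^{s+t}=P^sP^t$ for all $s,t\ge0$), $\gamma$ is invariant for $R^F$, i.e. $\gamma P^t=\gamma$ for all $t\ge0$, and $R^F$ is exponentially ergodic: there exist a function $V:\mathbb{R}\to\mathbb{R}$ with $V\in L^1(\gamma)$ and constants $c_1,c_2>0$ such that $$\|P^t(x,\cdot)-\gamma\|_{\mathrm{TV}}\le c_1e^{-c_2t}V(x)\qquad\text{for all }t\ge0,\ x\in\mathbb{R},$$ where $\|\cdot\|_{\mathrm{TV}}$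 is the total variation norm of a signed measure. -/

import Mathlib

open MeasureTheory ProbabilityTheory
open scoped NNReal ENNReal

namespace RadialMomentum

/-- The standard Rayleigh distribution `χ(2)`, with density `x * exp (-x^2 / 2)` on `x > 0`. -/
noncomputable def rayleigh : Measure ℝ :=
  volume.withDensity
    (fun x => ENNReal.ofReal (if 0 < x then x * Real.exp (-x ^ 2 / 2) else 0))

instance isProbabilityMeasure_rayleigh : IsProbabilityMeasure rayleigh := by
  have h0 : (fun x : ℝ => ENNReal.ofReal (if 0 < x then x * Real.exp (-x ^ 2 / 2) else 0))
      = (Set.Ioi (0 : ℝ)).indicator (fun x => ENNReal.ofReal (x * Real.exp (-x ^ 2 / 2))) := by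
    ext x
    by_cases hx : 0 < x <;> simp [hx]
  have hderiv : ∀ x ∈ Set.Ici (0 : ℝ), HasDerivAt (fun x : ℝ => -Real.exp (-x ^ 2 / 2))
      (x * Real.exp (-x ^ 2 / 2)) x := by
    intro x _
    have h1 : HasDerivAt (fun x : ℝ => -x ^ 2 / 2) (-x) x := by
      have h := ((hasDerivAt_pow 2 x).neg).div_const 2
      refine h.congr_deriv ?_
      norm_num
      ring
    exact h1.exp.neg.congr_deriv (by ring)
  have hpos : ∀ x ∈ Set.Ioi (0 : ℝ), 0 ≤ x * Real.exp (-x ^ 2 / 2) := by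
    intro x hx
    exact mul_nonneg (le_of_lt hx) (Real.exp_pos _).le
  have hlim : Filter.Tendsto (fun x : ℝ => -Real.exp (-x ^ 2 / 2)) Filter.atTop (nhds 0) := by
    have h2 : Filter.Tendsto (fun x : ℝ => -x ^ 2 / 2) Filter.atTop Filter.atBot := by
      have := (Filter.tendsto_pow_atTop (α := ℝ) (n := 2) (by norm_num)).atTop_div_const
        (show (0 : ℝ) < 2 by norm_num)
      have := Filter.tendsto_neg_atTop_atBot.comp this
      refine this.congr fun x => ?_
      simp [neg_div]
    simpa using (Real.tendsto_exp_atBot.comp h2).neg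
  have hint := integrableOn_Ioi_deriv_of_nonneg' hderiv hpos hlim
  have hval := integral_Ioi_of_hasDerivAt_of_nonneg' hderiv hpos hlim
  constructor
  rw [rayleigh, withDensity_apply _ MeasurableSet.univ, Measure.restrict_univ, h0,
    lintegral_indicator measurableSet_Ioi, ← ofReal_integral_eq_lintegral_ofReal hint
      ((ae_restrict_iff' measurableSet_Ioi).2 (Filter.Eventually.of_forall hpos)), hval]
  simp

/-- The jump rate `x_+ = max x 0` of the process. -/
noncomputable def rate (x : ℝ) : ℝ := max x 0

/-- The holding time in the state `y` before the next jump, as a function of the value `e` of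
a standard exponential variable: the process moves at unit speed, `s ↦ y + s`, and the jump
occurs as soon as the accumulated rate exceeds `e`.  For `e` standard exponential, its survival
function is `t ↦ exp (-∫ s in 0..t, rate (y + s))`. -/
noncomputable def holdingTime (y e : ℝ) : ℝ :=
  sInf {t : ℝ | 0 ≤ t ∧ e < ∫ s in (0 : ℝ)..t, rate (y + s)}

/-- The jump skeleton of the process started at `x`, driven by the sequence
`ω n = (e_n, τ_n)`: `skeleton x ω n = (S_n, Y_n)` is the time `S_n` of the `n`-th jump
(`S_0 = 0`) together with the state `Y_n` at that time (`Y_0 = x`).  The state right after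
the jump at the time `S_{n+1}` is `-τ_n`, independently of the past. -/
noncomputable def skeleton (x : ℝ) (ω : ℕ → ℝ × ℝ) : ℕ → ℝ × ℝ
  | 0 => (0, x)
  | n + 1 => ((skeleton x ω n).1 + holdingTime (skeleton x ω n).2 (ω n).1, -(ω n).2)

/-- The number of jumps up to (and including) the time `t`. -/
noncomputable def jumpCount (x : ℝ) (t : ℝ≥0) (ω : ℕ → ℝ × ℝ) : ℕ :=
  sInf {n : ℕ | (t : ℝ) < (skeleton x ω (n + 1)).1}

/-- The limiting radial momentum process `R^F` started at `x`: the piecewise deterministic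
Markov process on `ℝ` with unit-speed drift, jump rate `x_+`, and post-jump law that of `-τ`
with `τ` standard Rayleigh, i.e. with extended generator
`L f x = f' x + x_+ * (E[f (-τ)] - f x)`.  Between jumps, `R_t = Y_n + (t - S_n)` for
`S_n ≤ t < S_{n+1}`. -/
noncomputable def process (x : ℝ) (t : ℝ≥0) (ω : ℕ → ℝ × ℝ) : ℝ :=
  (skeleton x ω (jumpCount x t ω)).2 + ((t : ℝ) - (skeleton x ω (jumpCount x t ω)).1)

instance isProbabilityMeasure_expMeasure_one : IsProbabilityMeasure (expMeasure 1) :=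
  isProbabilityMeasure_expMeasure one_pos

/-- The law of the driving sequence: i.i.d. pairs of independent variables, the first standard
exponential, the second standard Rayleigh. -/
noncomputable def noiseLaw : Measure (ℕ → ℝ × ℝ) :=
  Measure.infinitePi (fun _ : ℕ => (expMeasure 1).prod rayleigh)

instance isProbabilityMeasure_noiseLaw : IsProbabilityMeasure noiseLaw := by
  unfold noiseLaw
  infer_instance

theorem continuous_rate : Continuous rate := by
  unfold rate
  fun_prop

theorem integral_rate (y t : ℝ) :
    ∫ s in (0 : ℝ)..t, rate (y + s) = (rate (y + t) ^ 2 - rate y ^ 2) / 2 := by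
  have hd : ∀ u : ℝ, HasDerivAt (fun u => rate u ^ 2 / 2) (rate u) u := by
    intro u
    rcases lt_trichotomy u 0 with hu | hu | hu
    · have h : (fun u : ℝ => rate u ^ 2 / 2) =ᶠ[nhds u] fun _ => 0 := by
        filter_upwards [Iio_mem_nhds hu] with v hv
        have hv' : v ≤ 0 := le_of_lt (Set.mem_Iio.1 hv)
        simp [rate, hv']
      have h2 : rate u = 0 := max_eq_right hu.le
      rw [h2]
      exact (hasDerivAt_const u (0 : ℝ)).congr_of_eventuallyEq h
    · subst hu
      have h2 : rate 0 = 0 := by simp [rate]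
      rw [h2, hasDerivAt_iff_isLittleO]
      refine Asymptotics.IsBigO.trans_isLittleO (g := fun v : ℝ => v ^ 2) ?_ ?_
      · refine Asymptotics.IsBigO.of_bound 1 (Filter.Eventually.of_forall fun v => ?_)
        have h3 : rate v ^ 2 ≤ v ^ 2 := by
          unfold rate
          rcases le_total v 0 with hv | hv
          · rw [max_eq_right hv]; nlinarith [sq_nonneg v]
          · rw [max_eq_left hv]
        have h4 : 0 ≤ rate v ^ 2 := sq_nonneg _
        simp only [h2, Real.norm_eq_abs, smul_eq_mul, mul_zero, sub_zero, one_mul]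
        rw [abs_of_nonneg (sq_nonneg v), abs_of_nonneg (by norm_num; linarith)]
        norm_num
        linarith
      · simpa using Asymptotics.isLittleO_pow_id (𝕜 := ℝ) (n := 2) (by norm_num)
    · have h : (fun u : ℝ => rate u ^ 2 / 2) =ᶠ[nhds u] fun u => u ^ 2 / 2 := by
        filter_upwards [Ioi_mem_nhds hu] with v hv
        have hv' : 0 ≤ v := le_of_lt (Set.mem_Ioi.1 hv)
        simp [rate, hv']
      have h2 : rate u = u := max_eq_left hu.le
      rw [h2]
      refine HasDerivAt.congr_of_eventuallyEq ?_ h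
      exact ((hasDerivAt_pow 2 u).div_const 2).congr_deriv (by norm_num)
  rw [intervalIntegral.integral_comp_add_left (fun u => rate u) y,
    intervalIntegral.integral_eq_sub_of_hasDerivAt (fun u _ => hd u)
      (continuous_rate.intervalIntegrable _ _)]
  simp only [add_zero]
  ring

/-- Closed form of the holding time (negative values of `e` have probability zero). -/
theorem holdingTime_eq (y e : ℝ) :
    holdingTime y e = if 0 ≤ e then Real.sqrt (rate y ^ 2 + 2 * e) - y else 0 := by
  have hry : y ≤ rate y := le_max_left _ _
  have hry0 : 0 ≤ rate y := le_max_right _ _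
  split_ifs with he
  · have hset : {t : ℝ | 0 ≤ t ∧ e < ∫ s in (0 : ℝ)..t, rate (y + s)}
        = Set.Ioi (Real.sqrt (rate y ^ 2 + 2 * e) - y) := by
      ext t
      simp only [Set.mem_ofPred_eq, Set.mem_Ioi, integral_rate]
      have hs : rate y ≤ Real.sqrt (rate y ^ 2 + 2 * e) := by
        apply Real.le_sqrt_of_sq_le
        linarith
      constructor
      · rintro ⟨ht, h⟩
        have h1 : rate y ^ 2 + 2 * e < rate (y + t) ^ 2 := by linarith
        have h2 : Real.sqrt (rate y ^ 2 + 2 * e) < rate (y + t) :=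
          (Real.sqrt_lt' (by
            have h6 : (0 : ℝ) ≤ rate (y + t) := le_max_right _ _
            rcases lt_or_eq_of_le h6 with h3 | h3
            · exact h3
            · rw [← h3] at h1
              nlinarith [sq_nonneg (rate y)])).2 h1
        have h3 : rate (y + t) = y + t := by
          rcases le_total (y + t) 0 with h4 | h4
          · have h5 : rate (y + t) = 0 := max_eq_right h4
            rw [h5] at h2
            linarith [Real.sqrt_nonneg (rate y ^ 2 + 2 * e)]
          · exact max_eq_left h4
        linarith
      · intro h
        have h1 : Real.sqrt (rate y ^ 2 + 2 * e) < y + t := by linarith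
        have h2 : rate (y + t) = y + t :=
          max_eq_left ((Real.sqrt_nonneg _).trans h1.le)
        refine ⟨by linarith, ?_⟩
        rw [h2]
        have := Real.lt_sq_of_sqrt_lt h1
        linarith
    rw [holdingTime, hset, csInf_Ioi]
  · push Not at he
    have hset : IsLeast {t : ℝ | 0 ≤ t ∧ e < ∫ s in (0 : ℝ)..t, rate (y + s)} 0 :=
      ⟨⟨le_rfl, by simpa using he⟩, fun t ht => ht.1⟩
    exact hset.csInf_eq

theorem measurable_holdingTime : Measurable (fun p : ℝ × ℝ => holdingTime p.1 p.2) := by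
  simp only [holdingTime_eq]
  have := continuous_rate.measurable
  refine Measurable.ite (measurableSet_le measurable_const measurable_snd) ?_ measurable_const
  fun_prop

theorem measurable_skeleton (n : ℕ) :
    Measurable (fun p : ℝ × (ℕ → ℝ × ℝ) => skeleton p.1 p.2 n) := by
  induction n with
  | zero =>
    simp only [skeleton]
    fun_prop
  | succ n ih =>
    simp only [skeleton]
    have h1 : Measurable (fun p : ℝ × (ℕ → ℝ × ℝ) => p.2 n) :=
      (measurable_pi_apply n).comp measurable_snd
    exact (ih.fst.add (measurable_holdingTime.comp (ih.snd.prodMk h1.fst))).prodMk h1.snd.neg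

theorem measurable_jumpCount (t : ℝ≥0) :
    Measurable (fun p : ℝ × (ℕ → ℝ × ℝ) => jumpCount p.1 t p.2) := by
  have hm : ∀ n : ℕ, MeasurableSet
      {p : ℝ × (ℕ → ℝ × ℝ) | (t : ℝ) < (skeleton p.1 p.2 (n + 1)).1} := fun n =>
    measurableSet_lt measurable_const (measurable_skeleton (n + 1)).fst
  refine measurable_of_Iic fun k => ?_
  have : (fun p : ℝ × (ℕ → ℝ × ℝ) => jumpCount p.1 t p.2) ⁻¹' Set.Iic k
      = (⋃ n ∈ Set.Iic k, {p | (t : ℝ) < (skeleton p.1 p.2 (n + 1)).1})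
        ∪ (⋂ n, {p | (t : ℝ) < (skeleton p.1 p.2 (n + 1)).1}ᶜ) := by
    ext p
    simp only [Set.mem_preimage, Set.mem_Iic, Set.mem_union, Set.mem_iUnion, Set.mem_iInter,
      Set.mem_compl_iff, Set.mem_ofPred_eq, exists_prop]
    constructor
    · intro h
      by_cases hne : {n : ℕ | (t : ℝ) < (skeleton p.1 p.2 (n + 1)).1}.Nonempty
      · exact Or.inl ⟨_, h, Nat.sInf_mem hne⟩
      · exact Or.inr fun n hn => hne ⟨n, hn⟩
    · rintro (⟨n, hn, h⟩ | h)
      · exact (Nat.sInf_le h).trans hn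
      · have : {n : ℕ | (t : ℝ) < (skeleton p.1 p.2 (n + 1)).1} = ∅ := by
          ext n
          simpa using h n
        simp [jumpCount, this]
  rw [this]
  exact (MeasurableSet.biUnion (Set.to_countable _) fun n _ => hm n).union
    (MeasurableSet.iInter fun n => (hm n).compl)

theorem measurable_process (t : ℝ≥0) :
    Measurable (fun p : ℝ × (ℕ → ℝ × ℝ) => process p.1 t p.2) := by
  have h : Measurable (fun p : ℝ × (ℕ → ℝ × ℝ) => skeleton p.1 p.2 (jumpCount p.1 t p.2)) :=
    measurable_from_prod_countable_right (f := fun q : ℕ × (ℝ × (ℕ → ℝ × ℝ)) =>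
      skeleton q.2.1 q.2.2 q.1) measurable_skeleton |>.comp
      ((measurable_jumpCount t).prodMk measurable_id)
  exact h.snd.add (measurable_const.sub h.fst)

/-- The transition kernel `P^t` of the process: `P^t(x, ·)` is the law of `R^F_t` given
`R^F_0 = x`. -/
noncomputable def transition (t : ℝ≥0) : Kernel ℝ ℝ where
  toFun := fun x => noiseLaw.map (process x t)
  measurable' := by
    have h : (fun x => noiseLaw.map (process x t))
        = fun x => (noiseLaw.map (Prod.mk x)).map
            (fun p : ℝ × (ℕ → ℝ × ℝ) => process p.1 t p.2) := by
      funext x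
      rw [Measure.map_map (measurable_process t) measurable_prodMk_left]
      rfl
    rw [h]
    exact (Measure.measurable_map _ (measurable_process t)).comp Measurable.map_prodMk_left

instance isMarkovKernel_transition (t : ℝ≥0) : IsMarkovKernel (transition t) :=
  ⟨fun _ => Measure.isProbabilityMeasure_map
    ((measurable_process t).comp measurable_prodMk_left).aemeasurable⟩

/-- The total variation norm `‖μ - ν‖_TV` of the difference of two finite measures, i.e. the
total mass of the variation of the signed measure `μ - ν`. -/
noncomputable def tvNorm (μ ν : Measure ℝ) [IsFiniteMeasure μ] [IsFiniteMeasure ν] : ℝ :=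
  (μ.toSignedMeasure - ν.toSignedMeasure).totalVariation.real Set.univ

end RadialMomentum

namespace RadialMomentum

/-! The process regenerates at each jump, so every claim reduces to a renewal equation. Conditioning
on the first jump writes `expect f t x` as a no-jump term plus the mean of `postJump f` at the
remaining time (`expect_eq`). Averaging the start over `-τ` closes this into an equation for
`postJump f` alone (`postJump_eq`), with increments the cycle lengths `H`. From `-τ` the rate
vanishes until the origin is reached, so `H ≥ τ`. Hence the number of jumps is almost surely finite
in bounded time, and `E[exp (-H)] < 1`, which gives a Gronwall bound for renewal inequalities in the
norm weighted by `exp (-t)` (`renewal_bound`).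

Semigroup: by lack of memory of the exponential clock, the shifted function `s ↦ postJump f (s + t)`
and `postJump (expect f t)` solve the same renewal equation, whose bounded solution is unique
(`expect_add`).

Invariance: the occupation measure of one cycle has density `P(τ > -w) * exp (-w_+ ^ 2 / 2) = exp
(-w ^ 2 / 2)` at `w`, so it is `γ` up to normalization (`lintegral_gaussianReal`). Integrating the
renewal equation in time shows that this measure is preserved (`lintegral_expect_gaussianReal`).

Ergodicity is Harris' theorem with `V = exp |x|`. The drift moves negative states towards the
origin, while for positive states the no-jump probability offsets the growth of `V`
(`exists_drift`). On `|x| ≤ R` a jump in the last unit of time before `R + 2` spreads mass over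
`[-2, -1]` (`exists_minorization`). `harris_contraction` combines the two into a contraction of
weighted oscillation, and averaging one starting point over `γ` turns it into convergence to `γ`. -/

/-! ### Joint measurability in time, starting point and noise. -/

theorem measurable_jumpCount_joint :
    Measurable (fun p : ℝ≥0 × ℝ × (ℕ → ℝ × ℝ) => jumpCount p.2.1 p.1 p.2.2) := by
  have hm : ∀ n : ℕ, MeasurableSet
      {p : ℝ≥0 × ℝ × (ℕ → ℝ × ℝ) | (p.1 : ℝ) < (skeleton p.2.1 p.2.2 (n + 1)).1} := fun n =>
    measurableSet_lt (by fun_prop) ((measurable_skeleton (n + 1)).fst.comp measurable_snd)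
  refine measurable_of_Iic fun k => ?_
  have : (fun p : ℝ≥0 × ℝ × (ℕ → ℝ × ℝ) => jumpCount p.2.1 p.1 p.2.2) ⁻¹' Set.Iic k
      = (⋃ n ∈ Set.Iic k, {p | (p.1 : ℝ) < (skeleton p.2.1 p.2.2 (n + 1)).1})
        ∪ (⋂ n, {p | (p.1 : ℝ) < (skeleton p.2.1 p.2.2 (n + 1)).1}ᶜ) := by
    ext p
    simp only [Set.mem_preimage, Set.mem_Iic, Set.mem_union, Set.mem_iUnion, Set.mem_iInter,
      Set.mem_compl_iff, Set.mem_ofPred_eq, exists_prop]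
    constructor
    · intro h
      by_cases hne : {n : ℕ | (p.1 : ℝ) < (skeleton p.2.1 p.2.2 (n + 1)).1}.Nonempty
      · exact Or.inl ⟨_, h, Nat.sInf_mem hne⟩
      · exact Or.inr fun n hn => hne ⟨n, hn⟩
    · rintro (⟨n, hn, h⟩ | h)
      · exact (Nat.sInf_le h).trans hn
      · have : {n : ℕ | (p.1 : ℝ) < (skeleton p.2.1 p.2.2 (n + 1)).1} = ∅ := by
          ext n
          simpa using h n
        simp [jumpCount, this]
  rw [this]
  exact (MeasurableSet.biUnion (Set.to_countable _) fun n _ => hm n).union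
    (MeasurableSet.iInter fun n => (hm n).compl)

theorem measurable_process_joint :
    Measurable (fun p : ℝ≥0 × ℝ × (ℕ → ℝ × ℝ) => process p.2.1 p.1 p.2.2) := by
  have h : Measurable (fun p : ℝ≥0 × ℝ × (ℕ → ℝ × ℝ) =>
      skeleton p.2.1 p.2.2 (jumpCount p.2.1 p.1 p.2.2)) :=
    measurable_from_prod_countable_right (f := fun q : ℕ × (ℝ × (ℕ → ℝ × ℝ)) =>
      skeleton q.2.1 q.2.2 q.1) measurable_skeleton |>.comp
      (measurable_jumpCount_joint.prodMk measurable_snd)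
  exact h.snd.add ((by fun_prop : Measurable fun p : ℝ≥0 × ℝ × (ℕ → ℝ × ℝ) => (p.1 : ℝ)).sub h.fst)

/-! ### Regeneration at the first jump. -/

/-- Prepend a first term to a sequence. -/
def consSeq {α : Type*} (p : α × (ℕ → α)) : ℕ → α
  | 0 => p.1
  | n + 1 => p.2 n

theorem measurable_consSeq {α : Type*} [MeasurableSpace α] :
    Measurable (consSeq : α × (ℕ → α) → ℕ → α) := by
  refine measurable_pi_iff.2 fun n => ?_
  cases n with
  | zero => exact measurable_fst
  | succ n => exact (measurable_pi_apply n).comp measurable_snd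

theorem map_consSeq_infinitePi {α : Type*} [MeasurableSpace α] (μ : Measure α)
    [IsProbabilityMeasure μ] :
    (μ.prod (Measure.infinitePi fun _ : ℕ => μ)).map consSeq
      = Measure.infinitePi fun _ : ℕ => μ := by
  classical
  refine Measure.eq_infinitePi (fun _ : ℕ => μ) fun s t ht => ?_
  have hpre : (consSeq ⁻¹' (Set.pi (s : Set ℕ) t) : Set (α × (ℕ → α)))
      = (if 0 ∈ s then t 0 else Set.univ) ×ˢ
        (Set.pi ((s.preimage Nat.succ Nat.succ_injective.injOn : Finset ℕ) : Set ℕ)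
          fun n => t (n + 1)) := by
    ext p
    simp only [Set.mem_preimage, Set.mem_pi, Finset.mem_coe, Set.mem_prod, Finset.mem_preimage]
    constructor
    · intro h
      refine ⟨?_, fun n hn => h (n + 1) hn⟩
      split_ifs with h0
      · exact h 0 h0
      · trivial
    · rintro ⟨h0, h1⟩ n hn
      cases n with
      | zero => rw [if_pos hn] at h0; exact h0
      | succ n => exact h1 n hn
  rw [Measure.map_apply measurable_consSeq (MeasurableSet.pi s.countable_toSet fun i _ => ht i),
    hpre, Measure.prod_prod, Measure.infinitePi_pi _ (fun i _ => ht (i + 1))]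
  have h1 : ∏ i ∈ s.preimage Nat.succ Nat.succ_injective.injOn, μ (t (i + 1))
      = ∏ n ∈ s.erase 0, μ (t n) := by
    refine Finset.prod_nbij Nat.succ ?_ Nat.succ_injective.injOn ?_ fun _ _ => rfl
    · intro n hn
      simpa using hn
    · intro n hn
      obtain ⟨m, rfl⟩ := Nat.exists_eq_succ_of_ne_zero (Finset.ne_of_mem_erase hn)
      exact ⟨m, by simpa using hn, rfl⟩
  rw [h1]
  split_ifs with h0
  · exact Finset.mul_prod_erase s (fun n => μ (t n)) h0
  · rw [measure_univ, one_mul, Finset.erase_eq_of_notMem h0]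

/-- Integral form of regeneration: once the first pair is removed, the rest of an i.i.d. sequence is
an independent copy of the whole. -/
theorem lintegral_noiseLaw {F : (ℕ → ℝ × ℝ) → ℝ≥0∞} (hF : Measurable F) :
    ∫⁻ ω, F ω ∂noiseLaw = ∫⁻ e, ∫⁻ y, ∫⁻ ω, F (consSeq ((e, y), ω)) ∂noiseLaw ∂rayleigh
      ∂(expMeasure 1) := by
  conv_lhs => rw [noiseLaw, ← map_consSeq_infinitePi ((expMeasure 1).prod rayleigh)]
  have h1 : Measurable fun p => F (consSeq p) := hF.comp measurable_consSeq
  rw [lintegral_map hF measurable_consSeq, lintegral_prod _ h1.aemeasurable,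
    lintegral_prod _ h1.lintegral_prod_right'.aemeasurable]
  rfl

theorem holdingTime_nonneg (y e : ℝ) : 0 ≤ holdingTime y e :=
  Real.sInf_nonneg fun _ ht => ht.1

theorem le_holdingTime_neg {y e : ℝ} (he : 0 ≤ e) : y ≤ holdingTime (-y) e := by
  rw [holdingTime_eq, if_pos he]
  linarith [Real.sqrt_nonneg (rate (-y) ^ 2 + 2 * e)]

theorem skeleton_succ_shift (x : ℝ) (e y : ℝ) (ω : ℕ → ℝ × ℝ) (n : ℕ) :
    skeleton x (consSeq ((e, y), ω)) (n + 1)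
      = (holdingTime x e + (skeleton (-y) ω n).1, (skeleton (-y) ω n).2) := by
  induction n with
  | zero => simp [skeleton, consSeq]
  | succ n ih =>
    rw [skeleton, ih]
    simp only [skeleton, consSeq, Prod.mk.injEq, and_true]
    ring

/-- The driving sequence produces only finitely many jumps in bounded time, from any start. -/
def NonExplosive (ω : ℕ → ℝ × ℝ) : Prop :=
  ∀ (x : ℝ) (t : ℝ), ∃ n, t < (skeleton x ω (n + 1)).1

theorem process_of_lt {x e y : ℝ} {ω : ℕ → ℝ × ℝ} {t : ℝ≥0} (h : (t : ℝ) < holdingTime x e) :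
    process x t (consSeq ((e, y), ω)) = x + t := by
  have h0 : jumpCount x t (consSeq ((e, y), ω)) = 0 := by
    refine Nat.eq_zero_of_le_zero (Nat.sInf_le ?_)
    simpa [skeleton, consSeq] using h
  simp [process, h0, skeleton]

theorem process_of_le {x e y : ℝ} {ω : ℕ → ℝ × ℝ} {t : ℝ≥0} (h : holdingTime x e ≤ t)
    (hω : NonExplosive ω) :
    process x t (consSeq ((e, y), ω)) = process (-y) (t - holdingTime x e).toNNReal ω := by
  have hc : ((t - holdingTime x e).toNNReal : ℝ) = t - holdingTime x e :=
    Real.coe_toNNReal _ (sub_nonneg.2 h)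
  have hj : jumpCount x t (consSeq ((e, y), ω))
      = jumpCount (-y) (t - holdingTime x e).toNNReal ω + 1 := by
    -- Non-explosion keeps this set nonempty. On the empty set `sInf` would take the default value
    -- `0` for both counts, and they would not differ by one.
    have hne : {n : ℕ | (((t - holdingTime x e).toNNReal : ℝ≥0) : ℝ)
        < (skeleton (-y) ω (n + 1)).1}.Nonempty := hω _ _
    refine le_antisymm (Nat.sInf_le ?_) (le_csInf ?_ ?_)
    · have := Nat.sInf_mem hne
      simp only [Set.mem_ofPred_eq, hc] at this
      simp only [Set.mem_ofPred_eq, skeleton_succ_shift, jumpCount, hc]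
      linarith
    · obtain ⟨n, hn⟩ := hne
      refine ⟨n + 1, ?_⟩
      simp only [Set.mem_ofPred_eq, hc] at hn
      simp only [Set.mem_ofPred_eq, skeleton_succ_shift]
      linarith
    · intro n hn
      simp only [Set.mem_ofPred_eq, skeleton_succ_shift] at hn
      cases n with
      | zero => simp [skeleton] at hn; linarith
      | succ n =>
        refine Nat.succ_le_succ (Nat.sInf_le ?_)
        simp only [Set.mem_ofPred_eq, hc]
        linarith
  rw [process, hj, skeleton_succ_shift, process, hc]
  ring

/-! ### Almost sure properties of the noise; non-explosion. -/

theorem expMeasure_eq : expMeasure 1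
    = volume.withDensity (fun x => ENNReal.ofReal (if 0 ≤ x then Real.exp (-x) else 0)) := by
  have : exponentialPDF 1 = fun x => ENNReal.ofReal (if 0 ≤ x then Real.exp (-x) else 0) := by
    ext x; simp [exponentialPDF_eq]
  rw [← this]; rfl

theorem ae_expMeasure_pos : ∀ᵐ e ∂(expMeasure 1), 0 < e := by
  rw [expMeasure_eq, ae_withDensity_iff (by
    refine (Measurable.ite measurableSet_Ici ?_ ?_).ennreal_ofReal <;> fun_prop)]
  have : ∀ᵐ x : ℝ, x ≠ 0 := Measure.ae_ne volume 0
  filter_upwards [this] with x hx h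
  by_contra hn
  exact h (by rw [if_neg (by intro h1; exact hn (lt_of_le_of_ne h1 hx.symm))]; simp)

theorem ae_rayleigh_pos : ∀ᵐ y ∂rayleigh, 0 < y := by
  rw [rayleigh, ae_withDensity_iff (by
    refine (Measurable.ite measurableSet_Ioi ?_ ?_).ennreal_ofReal <;> fun_prop)]
  refine Filter.Eventually.of_forall fun x h => ?_
  by_contra hn
  exact h (by rw [if_neg hn]; simp)

theorem sum_le_skeleton (x : ℝ) {ω : ℕ → ℝ × ℝ} (h : ∀ n, 0 ≤ (ω n).1) (n : ℕ) :
    ∑ i ∈ Finset.range n, (ω i).2 ≤ (skeleton x ω (n + 1)).1 := by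
  induction n with
  | zero => simpa [skeleton] using holdingTime_nonneg _ _
  | succ n ih =>
    rw [Finset.sum_range_succ, skeleton]
    have : (skeleton x ω (n + 1)).2 = -(ω n).2 := rfl
    have := le_holdingTime_neg (y := (ω n).2) (h (n + 1))
    simp_all only
    linarith

theorem rayleigh_Ici_one_pos : 0 < rayleigh (Set.Ici 1) := by
  rw [pos_iff_ne_zero]
  intro h
  rw [rayleigh, withDensity_apply_eq_zero (by
    refine (Measurable.ite measurableSet_Ioi ?_ ?_).ennreal_ofReal <;> fun_prop)] at h
  have : Set.Icc (1:ℝ) 2 ⊆ {x | ENNReal.ofReal (if 0 < x then x * Real.exp (-x ^ 2 / 2) else 0) ≠ 0}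
      ∩ Set.Ici 1 := by
    intro x hx
    have hx0 : 0 < x := by linarith [hx.1]
    refine ⟨?_, hx.1⟩
    simp only [Set.mem_ofPred_eq, if_pos hx0, ne_eq, ENNReal.ofReal_eq_zero, not_le]
    positivity
  have := measure_mono_null this h
  norm_num at this

/-- By the second Borel-Cantelli lemma infinitely many `τ_n` are at least `1`, and the jump times
dominate the partial sums of the `τ_n` (`sum_le_skeleton`). The exceptional null set depends on
neither the start nor the time, so the result applies to the restart at a random state and time. -/
theorem ae_nonExplosive : ∀ᵐ ω ∂noiseLaw, NonExplosive ω := by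
  have hev : ∀ n, MeasurePreserving (Function.eval n) noiseLaw ((expMeasure 1).prod rayleigh) :=
    fun n => measurePreserving_eval_infinitePi (fun _ : ℕ => (expMeasure 1).prod rayleigh) n
  have h1 : ∀ᵐ ω ∂noiseLaw, ∀ n, 0 < (ω n).1 := by
    refine ae_all_iff.2 fun n => ?_
    exact (hev n).quasiMeasurePreserving.ae
      (Measure.quasiMeasurePreserving_fst.ae ae_expMeasure_pos)
  have h2 : ∀ᵐ ω ∂noiseLaw, ∀ n, 0 < (ω n).2 := by
    refine ae_all_iff.2 fun n => ?_
    exact (hev n).quasiMeasurePreserving.ae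
      (Measure.quasiMeasurePreserving_snd.ae ae_rayleigh_pos)
  have hm : ∀ n, MeasurableSet {ω : ℕ → ℝ × ℝ | 1 ≤ (ω n).2} := fun n =>
    measurableSet_le measurable_const (measurable_pi_apply n).snd
  have hind : iIndepSet (fun n => {ω : ℕ → ℝ × ℝ | 1 ≤ (ω n).2}) noiseLaw := by
    have := iIndepFun_infinitePi (P := fun _ : ℕ => (expMeasure 1).prod rayleigh)
      (X := fun _ p => p.2) (fun _ => measurable_snd)
    rw [iIndepSet_iff_meas_biInter hm]
    intro s
    exact this.measure_inter_preimage_eq_mul s (sets := fun _ => Set.Ici 1)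
      (fun _ _ => measurableSet_Ici)
  have hval : ∀ n, noiseLaw {ω : ℕ → ℝ × ℝ | 1 ≤ (ω n).2} = rayleigh (Set.Ici 1) := by
    intro n
    have h := (hev n).measure_preimage
      (measurableSet_Ici.preimage measurable_snd : MeasurableSet
        (Prod.snd ⁻¹' (Set.Ici (1:ℝ)) : Set (ℝ × ℝ))).nullMeasurableSet
    rw [show (Prod.snd ⁻¹' (Set.Ici (1:ℝ)) : Set (ℝ × ℝ)) = Set.univ ×ˢ Set.Ici 1 by ext; simp,
      Measure.prod_prod, measure_univ, one_mul] at h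
    rw [← h]
    congr 1
    ext ω
    simp
  have h3 : ∀ᵐ ω ∂noiseLaw, ∃ᶠ n in Filter.atTop, 1 ≤ (ω n).2 := by
    have := measure_limsup_eq_one hm hind (by
      simp only [hval]
      exact ENNReal.tsum_const_eq_top_of_ne_zero rayleigh_Ici_one_pos.ne')
    have := (prob_compl_eq_zero_iff₀ (MeasurableSet.measurableSet_limsup hm).nullMeasurableSet).2
      this
    filter_upwards [compl_mem_ae_iff.2 this] with ω hω
    rw [compl_compl] at hω
    exact Filter.mem_limsup_iff_frequently_mem.1 hω
  filter_upwards [h1, h2, h3] with ω h1 h2 h3 x t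
  by_contra! hcon
  have hs : Summable fun n => (ω n).2 :=
    summable_of_sum_range_le (c := t) (fun n => (h2 n).le) fun n =>
      (sum_le_skeleton x (fun n => (h1 n).le) n).trans (hcon n)
  have := hs.tendsto_atTop_zero.eventually (gt_mem_nhds (show (0:ℝ) < 1 by norm_num))
  obtain ⟨n, h, h'⟩ := (h3.and_eventually this).exists
  linarith

/-! ### Accumulated rate, survival probability and lack of memory. -/

theorem rate_nonneg (x : ℝ) : 0 ≤ rate x := le_max_right _ _

theorem rate_mono {x y : ℝ} (h : x ≤ y) : rate x ≤ rate y := max_le_max h le_rfl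

theorem rate_of_nonneg {x : ℝ} (h : 0 ≤ x) : rate x = x := max_eq_left h

theorem rate_of_nonpos {x : ℝ} (h : x ≤ 0) : rate x = 0 := max_eq_right h

/-- The rate accumulated along the flow during a time `t` from the state `x`. -/
noncomputable def hazard (x t : ℝ) : ℝ := (rate (x + t) ^ 2 - rate x ^ 2) / 2

theorem hazard_nonneg {x t : ℝ} (ht : 0 ≤ t) : 0 ≤ hazard x t := by
  have h1 := rate_mono (show x ≤ x + t by linarith)
  have h2 := rate_nonneg x
  unfold hazard
  nlinarith

theorem hazard_add (x s t : ℝ) : hazard x (s + t) = hazard x s + hazard (x + s) t := by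
  unfold hazard
  rw [← add_assoc]
  ring

/-- At `e = 0` this fails for negative `x`: the clock rings only when the rate becomes positive,
whereas the hazard up to then is `0`. -/
theorem lt_holdingTime_iff {x t e : ℝ} (ht : 0 ≤ t) (he : 0 < e) :
    t < holdingTime x e ↔ hazard x t < e := by
  rw [holdingTime_eq, if_pos he.le, hazard, lt_sub_iff_add_lt]
  rcases le_or_gt (x + t) 0 with h | h
  · have h1 : rate x = 0 := rate_of_nonpos (by linarith)
    rw [rate_of_nonpos h, h1]
    have : 0 < Real.sqrt (0 ^ 2 + 2 * e) := Real.sqrt_pos.2 (by positivity)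
    constructor <;> intro _ <;> linarith
  · rw [add_comm t x, Real.lt_sqrt h.le, rate_of_nonneg h.le]
    constructor <;> intro _ <;> linarith

/-- The quantity `rate x ^ 2 + 2 * e` under the square root is conserved along the flow when the
hazard already spent is deducted from `e`. -/
theorem holdingTime_sub {x t e : ℝ} (ht : 0 ≤ t) (he : hazard x t ≤ e) :
    holdingTime x e - t = holdingTime (x + t) (e - hazard x t) := by
  rw [holdingTime_eq, holdingTime_eq, if_pos ((hazard_nonneg ht).trans he),
    if_pos (sub_nonneg.2 he), hazard]
  rw [show rate (x + t) ^ 2 + 2 * (e - (rate (x + t) ^ 2 - rate x ^ 2) / 2)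
    = rate x ^ 2 + 2 * e by ring]
  ring

/-- The probability that no jump occurs during a time `t` from the state `x`. -/
noncomputable def survival (x t : ℝ) : ℝ≥0∞ := ENNReal.ofReal (Real.exp (-hazard x t))

theorem survival_add (x s t : ℝ) : survival x (s + t) = survival x s * survival (x + s) t := by
  rw [survival, survival, survival, ← ENNReal.ofReal_mul (Real.exp_pos _).le, ← Real.exp_add,
    hazard_add, neg_add]

theorem survival_le_one {x t : ℝ} (ht : 0 ≤ t) : survival x t ≤ 1 := by
  rw [survival, ENNReal.ofReal_le_one, Real.exp_le_one_iff]
  linarith [hazard_nonneg (x := x) ht]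

theorem measurable_survival : Measurable fun p : ℝ × ℝ => survival p.1 p.2 := by
  have := continuous_rate.measurable
  unfold survival hazard
  fun_prop

theorem measurable_exp_density :
    Measurable fun x : ℝ => ENNReal.ofReal (if 0 ≤ x then Real.exp (-x) else 0) := by
  refine (Measurable.ite measurableSet_Ici ?_ ?_).ennreal_ofReal <;> fun_prop

/-- Lack of memory of the exponential distribution. -/
theorem lintegral_expMeasure_sub {a : ℝ} (ha : 0 ≤ a) {g : ℝ → ℝ≥0∞} (hg : Measurable g) :
    ∫⁻ e, (if a < e then g (e - a) else 0) ∂(expMeasure 1)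
      = ENNReal.ofReal (Real.exp (-a)) * ∫⁻ e, g e ∂(expMeasure 1) := by
  have hm : Measurable fun e => if a < e then g (e - a) else 0 :=
    Measurable.ite measurableSet_Ioi (hg.comp (measurable_id.sub_const a)) measurable_const
  rw [expMeasure_eq, lintegral_withDensity_eq_lintegral_mul _ measurable_exp_density hm,
    lintegral_withDensity_eq_lintegral_mul _ measurable_exp_density hg,
    ← lintegral_const_mul _ (measurable_exp_density.mul hg)]
  symm
  rw [← lintegral_sub_right_eq_self _ a]
  symm
  refine lintegral_congr_ae ?_
  -- The point `e = a` is discarded because the strict indicator `a < e` and the shifted density,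
  -- supported on `a ≤ e`, disagree there.
  filter_upwards [Measure.ae_ne volume a] with e he
  simp only [Pi.mul_apply]
  rcases lt_or_gt_of_ne he with h | h
  · rw [if_neg h.not_gt, if_neg (by linarith : ¬ 0 ≤ e - a)]
    simp
  · rw [if_pos h, if_pos (by linarith : 0 ≤ e), if_pos (by linarith : 0 ≤ e - a), ← mul_assoc,
      ← ENNReal.ofReal_mul (Real.exp_pos _).le, ← Real.exp_add]
    ring_nf

theorem measurable_holdingTime_right (x : ℝ) : Measurable (holdingTime x) :=
  measurable_holdingTime.comp measurable_prodMk_left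

/-- Given no jump during a time `t`, the residual holding time is that of the state reached. -/
theorem lintegral_holdingTime_sub (x : ℝ) {t : ℝ} (ht : 0 ≤ t) {g : ℝ → ℝ≥0∞}
    (hg : Measurable g) :
    ∫⁻ e, (if t < holdingTime x e then g (holdingTime x e - t) else 0) ∂(expMeasure 1)
      = survival x t * ∫⁻ e, g (holdingTime (x + t) e) ∂(expMeasure 1) := by
  refine Eq.trans ?_ (lintegral_expMeasure_sub (hazard_nonneg ht)
    (hg.comp (measurable_holdingTime_right (x + t))))
  refine lintegral_congr_ae ?_
  filter_upwards [ae_expMeasure_pos] with e he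
  simp only [lt_holdingTime_iff ht he]
  split_ifs with h
  · rw [holdingTime_sub ht h.le]
  · rfl

/-! ### The renewal equation. -/

/-- The expectation of `f` at time `t` for the process started at `x`; zero for `t < 0`. -/
noncomputable def expect (f : ℝ → ℝ≥0∞) (t x : ℝ) : ℝ≥0∞ :=
  if 0 ≤ t then ∫⁻ z, f z ∂(transition t.toNNReal x) else 0

/-- The expectation of `f` at time `t` for the process started from a fresh jump. -/
noncomputable def postJump (f : ℝ → ℝ≥0∞) (t : ℝ) : ℝ≥0∞ :=
  ∫⁻ y, expect f t (-y) ∂rayleigh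

theorem expect_of_neg {f : ℝ → ℝ≥0∞} {t : ℝ} (ht : t < 0) (x : ℝ) : expect f t x = 0 :=
  if_neg ht.not_ge

theorem postJump_of_neg {f : ℝ → ℝ≥0∞} {t : ℝ} (ht : t < 0) : postJump f t = 0 := by
  simp [postJump, expect_of_neg ht]

theorem lintegral_transition {f : ℝ → ℝ≥0∞} (hf : Measurable f) (t : ℝ≥0) (x : ℝ) :
    ∫⁻ z, f z ∂(transition t x) = ∫⁻ ω, f (process x t ω) ∂noiseLaw :=
  lintegral_map hf ((measurable_process t).comp measurable_prodMk_left)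

theorem measurable_expect {f : ℝ → ℝ≥0∞} (hf : Measurable f) :
    Measurable fun p : ℝ × ℝ => expect f p.1 p.2 := by
  simp only [expect, lintegral_transition hf]
  refine Measurable.ite (measurableSet_le measurable_const measurable_fst) ?_ measurable_const
  refine Measurable.lintegral_prod_right' (ν := noiseLaw)
    (f := fun q : (ℝ × ℝ) × (ℕ → ℝ × ℝ) => f (process q.1.2 q.1.1.toNNReal q.2)) ?_
  exact hf.comp (measurable_process_joint.comp
    (measurable_fst.fst.real_toNNReal.prodMk (measurable_fst.snd.prodMk measurable_snd)))

theorem measurable_postJump {f : ℝ → ℝ≥0∞} (hf : Measurable f) : Measurable (postJump f) := by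
  refine Measurable.lintegral_prod_right' (ν := rayleigh)
    (f := fun p : ℝ × ℝ => expect f p.1 (-p.2)) ?_
  exact (measurable_expect hf).comp (measurable_fst.prodMk measurable_snd.neg)

theorem expect_le {f : ℝ → ℝ≥0∞} {C : ℝ≥0∞} (h : ∀ x, f x ≤ C) (t x : ℝ) :
    expect f t x ≤ C := by
  unfold expect
  split_ifs
  · refine (lintegral_mono h).trans ?_
    simp
  · exact zero_le

theorem postJump_le {f : ℝ → ℝ≥0∞} {C : ℝ≥0∞} (h : ∀ x, f x ≤ C) (t : ℝ) :
    postJump f t ≤ C := by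
  refine (lintegral_mono fun y => expect_le h t (-y)).trans ?_
  simp

/-- The renewal equation obtained by conditioning on the first jump. -/
theorem expect_eq {f : ℝ → ℝ≥0∞} (hf : Measurable f) {t : ℝ} (ht : 0 ≤ t) (x : ℝ) :
    expect f t x = survival x t * f (x + t)
      + ∫⁻ e, postJump f (t - holdingTime x e) ∂(expMeasure 1) := by
  have h1 := lintegral_holdingTime_sub x ht (g := fun _ => f (x + t)) measurable_const
  simp only [lintegral_const, measure_univ, mul_one] at h1
  have hc : (t.toNNReal : ℝ) = t := Real.coe_toNNReal _ ht
  have hm : Measurable fun ω => f (process x t.toNNReal ω) :=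
    hf.comp ((measurable_process _).comp measurable_prodMk_left)
  rw [← h1, expect, if_pos ht, lintegral_transition hf, lintegral_noiseLaw hm,
    ← lintegral_add_left (Measurable.ite
      (measurableSet_lt measurable_const (measurable_holdingTime_right x)) measurable_const
      measurable_const)]
  refine lintegral_congr fun e => ?_
  split_ifs with h
  -- No jump has occurred by time `t`. The convention that expectations vanish at negative times
  -- removes such `e` from the renewal integral.
  · rw [postJump_of_neg (by linarith), add_zero]
    have : ∀ y ω, process x t.toNNReal (consSeq ((e, y), ω)) = x + t := fun y ω => by
      rw [process_of_lt (by rwa [hc]), hc]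
    simp [this]
  · rw [zero_add, postJump]
    refine lintegral_congr fun y => ?_
    rw [expect, if_pos (by linarith), lintegral_transition hf]
    refine lintegral_congr_ae ?_
    filter_upwards [ae_nonExplosive] with ω hω
    rw [process_of_le (by rw [hc]; linarith) hω, hc]

/-- Restarting the process from the state reached without a jump. -/
theorem survival_mul_expect {f : ℝ → ℝ≥0∞} (hf : Measurable f) {s t : ℝ} (hs : 0 ≤ s)
    (ht : 0 ≤ t) (x : ℝ) :
    survival x s * expect f t (x + s) = survival x (s + t) * f (x + (s + t))
      + ∫⁻ e, (if s < holdingTime x e then postJump f (s + t - holdingTime x e) else 0)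
          ∂(expMeasure 1) := by
  rw [expect_eq hf ht, mul_add, survival_add, mul_assoc, add_assoc]
  congr 1
  rw [← lintegral_holdingTime_sub x hs (g := fun r => postJump f (t - r))
    ((measurable_postJump hf).comp (measurable_const.sub measurable_id))]
  refine lintegral_congr fun e => ?_
  split_ifs
  · congr 1; ring
  · rfl

/-! ### Bounds and uniqueness for renewal equations. -/

/-- The Laplace transform of the Rayleigh distribution at `1`. -/
noncomputable def rayleighLaplace : ℝ≥0∞ := ∫⁻ y, ENNReal.ofReal (Real.exp (-y)) ∂rayleigh

theorem rayleighLaplace_lt_one : rayleighLaplace < 1 := by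
  have h : ∀ᵐ y ∂rayleigh, ENNReal.ofReal (Real.exp (-y)) < 1 := by
    filter_upwards [ae_rayleigh_pos] with y hy
    rw [ENNReal.ofReal_lt_one, Real.exp_lt_one_iff]
    linarith
  have h1 : ∫⁻ _, (1 : ℝ≥0∞) ∂rayleigh = 1 := by simp
  rw [rayleighLaplace, ← h1]
  refine lintegral_strict_mono (IsProbabilityMeasure.ne_zero _) aemeasurable_const ?_ h
  refine ne_top_of_le_ne_top (b := 1) (by simp) ?_
  rw [← h1]
  exact lintegral_mono_ae (h.mono fun y hy => hy.le)

/-- The law of the duration of a cycle, from one jump to the next, as an iterated integral. -/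
noncomputable def cycleIntegral (M : ℝ → ℝ≥0∞) : ℝ≥0∞ :=
  ∫⁻ y, ∫⁻ e, M (holdingTime (-y) e) ∂(expMeasure 1) ∂rayleigh

theorem measurable_cycle : Measurable fun p : ℝ × ℝ => holdingTime (-p.1) p.2 :=
  measurable_holdingTime.comp (measurable_fst.neg.prodMk measurable_snd)

/-- A cycle from `-y` lasts at least `y`, the time needed to reach the region of positive rate. -/
theorem cycleIntegral_exp_neg_le :
    cycleIntegral (fun h => ENNReal.ofReal (Real.exp (-h))) ≤ rayleighLaplace := by
  refine lintegral_mono fun y => ?_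
  calc ∫⁻ e, ENNReal.ofReal (Real.exp (-holdingTime (-y) e)) ∂(expMeasure 1)
      ≤ ∫⁻ _, ENNReal.ofReal (Real.exp (-y)) ∂(expMeasure 1) := by
        refine lintegral_mono_ae ?_
        filter_upwards [ae_expMeasure_pos] with e he
        exact ENNReal.ofReal_le_ofReal (Real.exp_le_exp.2 (neg_le_neg (le_holdingTime_neg he.le)))
    _ = _ := by simp

/-- A Gronwall-type estimate for renewal inequalities. -/
theorem renewal_bound {M : ℝ → ℝ≥0∞} {A C : ℝ≥0∞} {T : ℝ} (hC : C ≠ ∞) (hMC : ∀ t, M t ≤ C)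
    (hneg : ∀ t < 0, M t = 0)
    (hM : ∀ t, 0 ≤ t → t ≤ T → M t ≤ A + cycleIntegral fun h => M (t - h)) {t : ℝ}
    (ht : t ≤ T) : M t ≤ ENNReal.ofReal (Real.exp t) * (A / (1 - rayleighLaplace)) := by
  set w : ℝ → ℝ≥0∞ := fun t => ENNReal.ofReal (Real.exp (-t)) with hw
  -- In this weighted supremum, convolution with the cycle law contracts by `rayleighLaplace < 1`.
  -- The bound `C` serves only to make `B` finite, so that it can be absorbed on the left; it does
  -- not enter the conclusion.
  set B : ℝ≥0∞ := ⨆ t ≤ T, w t * M t with hB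
  have hwle : ∀ t, 0 ≤ t → w t ≤ 1 := fun t ht => by
    rw [hw, ENNReal.ofReal_le_one, Real.exp_le_one_iff]; linarith
  have hwtop : ∀ t, w t ≠ ∞ := fun t => ENNReal.ofReal_ne_top
  have hle : ∀ t ≤ T, w t * M t ≤ B := fun t ht => le_iSup₂ (f := fun t (_ : t ≤ T) => w t * M t) t ht
  have hBC : B ≤ C := by
    refine iSup₂_le fun t _ => ?_
    rcases lt_or_ge t 0 with h | h
    · simp [hneg t h]
    · exact (mul_le_mul' (hwle t h) (hMC t)).trans (one_mul C).le
  have hBtop : B ≠ ∞ := ne_top_of_le_ne_top hC hBC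
  have hstep : B ≤ A + B * rayleighLaplace := by
    refine iSup₂_le fun t htT => ?_
    rcases lt_or_ge t 0 with h | h
    · simp [hneg t h]
    · calc w t * M t ≤ w t * (A + cycleIntegral fun h => M (t - h)) := by
            gcongr; exact hM t h htT
        _ = w t * A + cycleIntegral fun h => w t * M (t - h) := by
            rw [mul_add, cycleIntegral, cycleIntegral, ← lintegral_const_mul' _ _ (hwtop t)]
            simp only [lintegral_const_mul' _ _ (hwtop t)]
        _ ≤ A + cycleIntegral fun h => B * w h := by
            refine add_le_add ((mul_le_mul' (hwle t h) le_rfl).trans (one_mul A).le) ?_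
            refine lintegral_mono fun y => lintegral_mono fun e => ?_
            have h1 : w t = w (t - holdingTime (-y) e) * w (holdingTime (-y) e) := by
              simp only [hw]
              rw [← ENNReal.ofReal_mul (Real.exp_pos _).le, ← Real.exp_add]
              ring_nf
            calc w t * M (t - holdingTime (-y) e)
                = w (t - holdingTime (-y) e) * M (t - holdingTime (-y) e)
                    * w (holdingTime (-y) e) := by rw [h1]; ring
              _ ≤ _ := by
                exact mul_le_mul' (hle _ (by linarith [holdingTime_nonneg (-y) e])) le_rfl
        _ = A + B * cycleIntegral w := by
            simp only [cycleIntegral, lintegral_const_mul' _ _ hBtop]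
        _ ≤ _ := by gcongr; exact cycleIntegral_exp_neg_le
  have hκ : 1 - rayleighLaplace ≠ 0 := (tsub_pos_of_lt rayleighLaplace_lt_one).ne'
  have hBA : B ≤ A / (1 - rayleighLaplace) := by
    rw [ENNReal.le_div_iff_mul_le (Or.inl hκ)
      (Or.inl (ne_top_of_le_ne_top ENNReal.one_ne_top tsub_le_self)),
      ENNReal.mul_sub (fun _ _ => hBtop), mul_one]
    exact tsub_le_iff_right.2 hstep
  calc M t = ENNReal.ofReal (Real.exp t) * (w t * M t) := by
        rw [← mul_assoc, ← ENNReal.ofReal_mul (Real.exp_pos _).le, ← Real.exp_add]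
        simp
    _ ≤ _ := by gcongr; exact (hle t ht).trans hBA

/-- Uniqueness of bounded solutions of the renewal equation. -/
theorem renewal_unique_le {p q α : ℝ → ℝ≥0∞} {C : ℝ≥0∞} (hC : C ≠ ∞) (hp : ∀ t, p t ≤ C)
    (hqm : Measurable q) (hpneg : ∀ t < 0, p t = 0)
    (hpe : ∀ t, 0 ≤ t → p t = α t + cycleIntegral fun h => p (t - h))
    (hqe : ∀ t, 0 ≤ t → q t = α t + cycleIntegral fun h => q (t - h)) (t : ℝ) : p t ≤ q t := by
  -- The truncated difference satisfies the homogeneous inequality, so `renewal_bound` with `A = 0`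
  -- forces it to vanish. Only `p` has to be bounded.
  have key : ∀ t, 0 ≤ t → t ≤ t → p t - q t ≤ 0 + cycleIntegral fun h => p (t - h) - q (t - h) := by
    intro t ht _
    have hm : Measurable fun z : ℝ × ℝ => q (t - holdingTime (-z.1) z.2) :=
      hqm.comp (measurable_const.sub measurable_cycle)
    rw [hpe t ht, hqe t ht, zero_add]
    refine add_tsub_add_le_tsub_left.trans ?_
    refine (lintegral_sub_le _ _ hm.lintegral_prod_right').trans ?_
    exact lintegral_mono fun y => lintegral_sub_le _ _ (hm.comp measurable_prodMk_left)
  have := renewal_bound (M := fun t => p t - q t) (A := 0) (T := t) hC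
    (fun t => tsub_le_self.trans (hp t)) (fun t ht => by simp [hpneg t ht])
    (fun s hs _ => key s hs le_rfl) le_rfl
  rw [ENNReal.zero_div, mul_zero, nonpos_iff_eq_zero] at this
  exact tsub_eq_zero_iff_le.1 this

/-! ### The Chapman-Kolmogorov equation. -/

theorem postJump_eq {f : ℝ → ℝ≥0∞} (hf : Measurable f) {t : ℝ} (ht : 0 ≤ t) :
    postJump f t = ∫⁻ y, survival (-y) t * f (-y + t) ∂rayleigh
      + cycleIntegral fun h => postJump f (t - h) := by
  have hs := measurable_survival
  rw [postJump, cycleIntegral, ← lintegral_add_left]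
  · exact lintegral_congr fun y => expect_eq hf ht (-y)
  · exact (hs.comp (measurable_neg.prodMk measurable_const)).mul
      (hf.comp (measurable_neg.add_const t))

/-- The renewal equation satisfied by a time shift of the semigroup. -/
theorem expect_add_eq {f : ℝ → ℝ≥0∞} (hf : Measurable f) {s t : ℝ} (hs : 0 ≤ s) (ht : 0 ≤ t)
    (x : ℝ) :
    expect f (s + t) x = survival x s * expect f t (x + s)
      + ∫⁻ e, (if 0 ≤ s - holdingTime x e then postJump f (s - holdingTime x e + t) else 0)
          ∂(expMeasure 1) := by
  have hh := measurable_holdingTime_right x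
  rw [survival_mul_expect hf hs ht, expect_eq hf (add_nonneg hs ht), add_assoc,
    ← lintegral_add_left (by
      exact Measurable.ite (measurableSet_lt measurable_const hh)
        ((measurable_postJump hf).comp (measurable_const.sub hh)) measurable_const)]
  congr 1
  refine lintegral_congr fun e => ?_
  -- A first jump after `s` belongs to the process restarted at `x + s`; one before `s` gives the
  -- shifted renewal term.
  by_cases h : s < holdingTime x e
  · rw [if_pos h, if_neg (by linarith), add_zero]
  · rw [if_neg h, if_pos (by linarith), zero_add]
    congr 1; ring

theorem expect_add {f : ℝ → ℝ≥0∞} (hf : Measurable f) {C : ℝ≥0∞} (hC : C ≠ ∞)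
    (hfC : ∀ x, f x ≤ C) {s t : ℝ} (hs : 0 ≤ s) (ht : 0 ≤ t) (x : ℝ) :
    expect f (s + t) x = expect (expect f t) s x := by
  have hg : Measurable (expect f t) := (measurable_expect hf).comp measurable_prodMk_left
  -- The cutoff at `s = 0` makes `p` vanish at negative times, as `q` does; both then solve one
  -- renewal equation in `s`, with the same forcing term.
  set p : ℝ → ℝ≥0∞ := fun s => if 0 ≤ s then postJump f (s + t) else 0 with hp
  set q : ℝ → ℝ≥0∞ := postJump (expect f t) with hq
  have hpm : Measurable p := Measurable.ite measurableSet_Ici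
    ((measurable_postJump hf).comp (measurable_id.add_const t)) measurable_const
  have hsv : ∀ s, Measurable fun y => survival (-y) s * expect f t (-y + s) := fun s =>
    (measurable_survival.comp (measurable_neg.prodMk measurable_const)).mul
      (hg.comp (measurable_neg.add_const s))
  have hpe : ∀ s, 0 ≤ s → p s = ∫⁻ y, survival (-y) s * expect f t (-y + s) ∂rayleigh
      + cycleIntegral fun h => p (s - h) := by
    intro s hs
    simp only [hp, if_pos hs]
    rw [postJump, cycleIntegral, ← lintegral_add_left (hsv s)]
    exact lintegral_congr fun y => expect_add_eq hf hs ht (-y)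
  have hqe : ∀ s, 0 ≤ s → q s = ∫⁻ y, survival (-y) s * expect f t (-y + s) ∂rayleigh
      + cycleIntegral fun h => q (s - h) := fun s hs => postJump_eq hg hs
  have hpC : ∀ s, p s ≤ C := fun s => by
    simp only [hp]
    split_ifs
    · exact postJump_le hfC _
    · exact zero_le
  have hpneg : ∀ s < 0, p s = 0 := fun s hs => if_neg hs.not_ge
  have hpq : p = q := by
    funext r
    exact le_antisymm
      (renewal_unique_le hC hpC (measurable_postJump hg) hpneg hpe hqe r)
      (renewal_unique_le hC (postJump_le (expect_le hfC t)) hpm (fun s hs => postJump_of_neg hs)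
        hqe hpe r)
  rw [expect_add_eq hf hs ht, expect_eq hg hs]
  congr 1
  exact lintegral_congr fun e => congrFun hpq (s - holdingTime x e)

theorem expect_coe (f : ℝ → ℝ≥0∞) (t : ℝ≥0) (x : ℝ) :
    expect f t x = ∫⁻ z, f z ∂(transition t x) := by
  rw [expect, if_pos t.coe_nonneg, Real.toNNReal_coe]

/-- The Chapman-Kolmogorov equation. -/
theorem transition_add (s t : ℝ≥0) : transition (s + t) = transition t ∘ₖ transition s := by
  refine Kernel.ext fun x => Measure.ext fun A hA => ?_
  have hf : Measurable (A.indicator (1 : ℝ → ℝ≥0∞)) := measurable_one.indicator hA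
  have h := expect_add hf ENNReal.one_ne_top (fun x => Set.indicator_le_self' (by simp) x)
    s.coe_nonneg t.coe_nonneg x
  rw [← NNReal.coe_add, expect_coe, expect_coe] at h
  simp only [expect_coe, lintegral_indicator_one hA] at h
  rw [h, Kernel.comp_apply' _ _ _ hA]

/-! ### Invariance of the Gaussian via the occupation measure of a cycle. -/

theorem measurable_rayleigh_density : Measurable fun x : ℝ =>
    ENNReal.ofReal (if 0 < x then x * Real.exp (-x ^ 2 / 2) else 0) := by
  refine (Measurable.ite measurableSet_Ioi ?_ ?_).ennreal_ofReal <;> fun_prop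

theorem rayleigh_Ioi (a : ℝ) :
    rayleigh (Set.Ioi a) = ENNReal.ofReal (Real.exp (-rate a ^ 2 / 2)) := by
  rcases lt_or_ge a 0 with ha | ha
  · rw [rate_of_nonpos ha.le]
    have : rayleigh (Set.Ioi a) = 1 := (mem_ae_iff_prob_eq_one measurableSet_Ioi).1
      (ae_rayleigh_pos.mono fun y hy => ha.trans hy)
    simp [this]
  · rw [rate_of_nonneg ha]
    have hderiv : ∀ x ∈ Set.Ici a, HasDerivAt (fun x : ℝ => -Real.exp (-x ^ 2 / 2))
        (x * Real.exp (-x ^ 2 / 2)) x := by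
      intro x _
      have h1 : HasDerivAt (fun x : ℝ => -x ^ 2 / 2) (-x) x := by
        have h := ((hasDerivAt_pow 2 x).neg).div_const 2
        refine h.congr_deriv ?_
        norm_num
        ring
      exact h1.exp.neg.congr_deriv (by ring)
    have hpos : ∀ x ∈ Set.Ioi a, 0 ≤ x * Real.exp (-x ^ 2 / 2) := fun x hx =>
      mul_nonneg (ha.trans hx.le) (Real.exp_pos _).le
    have hlim : Filter.Tendsto (fun x : ℝ => -Real.exp (-x ^ 2 / 2)) Filter.atTop (nhds 0) := by
      have h2 : Filter.Tendsto (fun x : ℝ => -x ^ 2 / 2) Filter.atTop Filter.atBot := by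
        have := (Filter.tendsto_pow_atTop (α := ℝ) (n := 2) (by norm_num)).atTop_div_const
          (show (0 : ℝ) < 2 by norm_num)
        have := Filter.tendsto_neg_atTop_atBot.comp this
        refine this.congr fun x => ?_
        simp [neg_div]
      simpa using (Real.tendsto_exp_atBot.comp h2).neg
    have hint := integrableOn_Ioi_deriv_of_nonneg' hderiv hpos hlim
    have hval := integral_Ioi_of_hasDerivAt_of_nonneg' hderiv hpos hlim
    rw [rayleigh, withDensity_apply _ measurableSet_Ioi, setLIntegral_congr_fun measurableSet_Ioi
      (g := fun x => ENNReal.ofReal (x * Real.exp (-x ^ 2 / 2)))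
      (fun x hx => by simp only [if_pos (ha.trans_lt hx)]),
      ← ofReal_integral_eq_lintegral_ofReal hint
      ((ae_restrict_iff' measurableSet_Ioi).2 (Filter.Eventually.of_forall hpos)), hval]
    simp

theorem rate_sq_add_rate_neg_sq (x : ℝ) : rate x ^ 2 + rate (-x) ^ 2 = x ^ 2 := by
  rcases le_total 0 x with h | h
  · rw [rate_of_nonneg h, rate_of_nonpos (by linarith : -x ≤ 0)]; ring
  · rw [rate_of_nonpos h, rate_of_nonneg (by linarith : 0 ≤ -x)]; ring

/-- The contribution at age `s` of a cycle still running. -/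
noncomputable def ageIntegral (g : ℝ → ℝ≥0∞) (s : ℝ) : ℝ≥0∞ :=
  ∫⁻ y, survival (-y) s * g (-y + s) ∂rayleigh

theorem measurable_ageIntegrand {g : ℝ → ℝ≥0∞} (hg : Measurable g) :
    Measurable fun p : ℝ × ℝ => survival (-p.2) p.1 * g (-p.2 + p.1) :=
  (measurable_survival.comp (measurable_snd.neg.prodMk measurable_fst)).mul
    (hg.comp (measurable_snd.neg.add measurable_fst))

theorem measurable_ageIntegral {g : ℝ → ℝ≥0∞} (hg : Measurable g) : Measurable (ageIntegral g) :=
  (measurable_ageIntegrand hg).lintegral_prod_right'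

/-- The standard Gaussian is the normalized occupation measure of a cycle. -/
theorem lintegral_gaussianReal {g : ℝ → ℝ≥0∞} (hg : Measurable g) :
    ∫⁻ x, g x ∂(gaussianReal 0 1)
      = ENNReal.ofReal (Real.sqrt (2 * Real.pi))⁻¹ * ∫⁻ s in Set.Ici 0, ageIntegral g s := by
  have hm := measurable_ageIntegrand hg
  have h1 : ∫⁻ s in Set.Ici 0, ageIntegral g s
      = ∫⁻ w, ENNReal.ofReal (Real.exp (-w ^ 2 / 2)) * g w := by
    calc ∫⁻ s in Set.Ici 0, ageIntegral g s
        = ∫⁻ y, (∫⁻ s in Set.Ioi 0, survival (-y) s * g (-y + s)) ∂rayleigh := by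
          rw [setLIntegral_congr Ioi_ae_eq_Ici.symm]
          exact lintegral_lintegral_swap hm.aemeasurable
      -- Substitution of the position `w = -y + s` for the age `s`. As `-y ≤ 0`, survival up to `w`
      -- depends on `w` alone, and the Rayleigh tail at `-w` supplies the other half of the Gaussian
      -- exponent.
      _ = ∫⁻ y, (∫⁻ w, (Set.Ioi (-w)).indicator
            (fun _ => ENNReal.ofReal (Real.exp (-rate w ^ 2 / 2)) * g w) y) ∂rayleigh := by
          refine lintegral_congr_ae ?_
          filter_upwards [ae_rayleigh_pos] with y hy
          rw [← lintegral_indicator measurableSet_Ioi, ← lintegral_add_right_eq_self _ y]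
          refine lintegral_congr fun w => ?_
          simp only [Set.indicator, Set.mem_Ioi, survival, hazard]
          rw [show -y + (w + y) = w by ring, rate_of_nonpos (by linarith : -y ≤ 0)]
          by_cases h : 0 < w + y
          · rw [if_pos h, if_pos (by linarith)]
            ring_nf
          · rw [if_neg h, if_neg (by linarith)]
      _ = ∫⁻ w, ∫⁻ y, (Set.Ioi (-w)).indicator
            (fun _ => ENNReal.ofReal (Real.exp (-rate w ^ 2 / 2)) * g w) y ∂rayleigh := by
          refine lintegral_lintegral_swap (Measurable.aemeasurable ?_)
          have hr := continuous_rate.measurable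
          exact Measurable.ite (measurableSet_lt (measurable_snd.neg) measurable_fst)
            (by fun_prop) measurable_const
      _ = _ := by
          refine lintegral_congr fun w => ?_
          rw [lintegral_indicator_const measurableSet_Ioi, rayleigh_Ioi, mul_right_comm,
            ← ENNReal.ofReal_mul (Real.exp_pos _).le, ← Real.exp_add,
            ← rate_sq_add_rate_neg_sq w]
          ring_nf
  rw [h1, gaussianReal_of_var_ne_zero _ one_ne_zero,
    lintegral_withDensity_eq_lintegral_mul _ (measurable_gaussianPDF 0 1) hg,
    ← lintegral_const_mul' _ _ ENNReal.ofReal_ne_top]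
  refine lintegral_congr fun w => ?_
  rw [Pi.mul_apply, gaussianPDF, gaussianPDFReal, ENNReal.ofReal_mul (by positivity), mul_assoc]
  simp

theorem lintegral_cycleIntegral {k : ℝ → ℝ → ℝ≥0∞} (hk : Measurable (Function.uncurry k))
    (μ : Measure ℝ) [SFinite μ] :
    ∫⁻ r, cycleIntegral (k r) ∂μ = cycleIntegral fun h => ∫⁻ r, k r h ∂μ := by
  have h1 : Measurable fun p : (ℝ × ℝ) × ℝ => k p.1.1 (holdingTime (-p.1.2) p.2) :=
    hk.comp (measurable_fst.fst.prodMk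
      (measurable_cycle.comp (measurable_fst.snd.prodMk measurable_snd)))
  unfold cycleIntegral
  rw [lintegral_lintegral_swap (h1.lintegral_prod_right').aemeasurable]
  refine lintegral_congr fun y => ?_
  refine lintegral_lintegral_swap (Measurable.aemeasurable ?_)
  exact h1.comp ((measurable_fst.prodMk measurable_const).prodMk measurable_snd)

theorem cycleIntegral_congr {M N : ℝ → ℝ≥0∞} (h : ∀ r, 0 ≤ r → M r = N r) :
    cycleIntegral M = cycleIntegral N :=
  lintegral_congr fun _ => lintegral_congr fun _ => h _ (holdingTime_nonneg _ _)

theorem cycleIntegral_const (c : ℝ≥0∞) : cycleIntegral (fun _ => c) = c := by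
  simp [cycleIntegral]

theorem cycleIntegral_mono {M N : ℝ → ℝ≥0∞} (h : ∀ r, 0 ≤ r → M r ≤ N r) :
    cycleIntegral M ≤ cycleIntegral N :=
  lintegral_mono fun _ => lintegral_mono fun _ => h _ (holdingTime_nonneg _ _)

theorem cycleIntegral_add {M N : ℝ → ℝ≥0∞} (hM : Measurable M) :
    cycleIntegral (fun h => M h + N h) = cycleIntegral M + cycleIntegral N := by
  have h1 : Measurable fun p : ℝ × ℝ => M (holdingTime (-p.1) p.2) := hM.comp measurable_cycle
  unfold cycleIntegral
  rw [← lintegral_add_left h1.lintegral_prod_right']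
  exact lintegral_congr fun y => lintegral_add_left (h1.comp measurable_prodMk_left) _

theorem measurable_setLIntegral_Iio {m : ℝ → ℝ≥0∞} (hm : Measurable m) :
    Measurable fun u => ∫⁻ r in Set.Iio u, m r := by
  have : (fun u => ∫⁻ r in Set.Iio u, m r) = fun u => ∫⁻ r, (if r < u then m r else 0) := by
    funext u
    rw [← lintegral_indicator measurableSet_Iio]
    rfl
  rw [this]
  refine Measurable.lintegral_prod_right' (ν := volume)
    (f := fun p : ℝ × ℝ => if p.2 < p.1 then m p.2 else 0) ?_
  exact Measurable.ite (measurableSet_lt measurable_snd measurable_fst)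
    (hm.comp measurable_snd) measurable_const

/-- A cycle of age `s` either survives another time `t`, reaching age `s + t`, or ends at some age
`h` in between and hands over to a fresh cycle. -/
theorem ageIntegral_expect {f : ℝ → ℝ≥0∞} (hf : Measurable f) {s t : ℝ} (hs : 0 ≤ s)
    (ht : 0 ≤ t) :
    ageIntegral (expect f t) s = ageIntegral f (s + t)
      + cycleIntegral fun h => if s < h then postJump f (s + t - h) else 0 := by
  have h1 : Measurable fun y => survival (-y) (s + t) * f (-y + (s + t)) :=
    (measurable_survival.comp (measurable_neg.prodMk measurable_const)).mul
      (hf.comp (measurable_neg.add_const (s + t)))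
  rw [ageIntegral, ageIntegral, cycleIntegral, ← lintegral_add_left h1]
  exact lintegral_congr fun y => survival_mul_expect hf hs ht (-y)

theorem lintegral_expect_gaussianReal {f : ℝ → ℝ≥0∞} (hf : Measurable f) {C : ℝ≥0∞} (hC : C ≠ ∞)
    (hfC : ∀ x, f x ≤ C) {t : ℝ} (ht : 0 ≤ t) :
    ∫⁻ x, expect f t x ∂(gaussianReal 0 1) = ∫⁻ x, f x ∂(gaussianReal 0 1) := by
  have hg : Measurable (expect f t) := (measurable_expect hf).comp measurable_prodMk_left
  set m : ℝ → ℝ≥0∞ := postJump f with hm_def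
  have hm : Measurable m := measurable_postJump hf
  have hα : Measurable (ageIntegral f) := measurable_ageIntegral hf
  set F : ℝ → ℝ≥0∞ := fun u => ∫⁻ r in Set.Iio u, m r with hF
  have hFm : Measurable F := measurable_setLIntegral_Iio hm
  have hFt : ∀ u ≤ t, F u ≤ C * ENNReal.ofReal t := by
    intro u hu
    calc F u ≤ ∫⁻ r in Set.Iio t, m r := lintegral_mono_set (Set.Iio_subset_Iio hu)
      _ ≤ ∫⁻ r in Set.Iio t, (Set.Ici 0).indicator (fun _ => C) r := by
          refine lintegral_mono fun r => ?_
          by_cases h : 0 ≤ r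
          · rw [Set.indicator_of_mem (Set.mem_Ici.2 h)]; exact postJump_le hfC r
          · rw [hm_def, postJump_of_neg (not_le.1 h)]; exact zero_le
      _ = C * ENNReal.ofReal t := by
          rw [lintegral_indicator_const measurableSet_Ici, Measure.restrict_apply measurableSet_Ici,
            Set.Ici_inter_Iio, Real.volume_Ico, sub_zero]
  -- The renewal equation integrated over times below `t`.
  have hFrenew : F t = (∫⁻ r in Set.Iio t, (Set.Ici 0).indicator (ageIntegral f) r)
      + cycleIntegral fun h => F (t - h) := by
    have hk : Measurable (Function.uncurry fun r h => m (r - h)) :=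
      hm.comp (measurable_fst.sub measurable_snd)
    have h1 : ∀ r, m r = (Set.Ici 0).indicator (ageIntegral f) r
        + cycleIntegral fun h => m (r - h) := by
      intro r
      by_cases h : 0 ≤ r
      · rw [Set.indicator_of_mem (Set.mem_Ici.2 h)]; exact postJump_eq hf h
      · rw [Set.indicator_of_notMem (by simpa using h),
          cycleIntegral_congr (N := fun _ => 0), cycleIntegral_const, hm_def,
          postJump_of_neg (not_le.1 h), add_zero]
        intro s hs
        exact postJump_of_neg (by linarith [not_le.1 h])
    have h2 : F t = ∫⁻ r in Set.Iio t, ((Set.Ici 0).indicator (ageIntegral f) r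
        + cycleIntegral fun h => m (r - h)) := lintegral_congr h1
    rw [h2, lintegral_add_left (hα.indicator measurableSet_Ici), lintegral_cycleIntegral hk]
    congr 1
    refine cycleIntegral_congr fun h _ => ?_
    rw [hF]
    simp only
    rw [← lintegral_indicator measurableSet_Iio, ← lintegral_indicator measurableSet_Iio,
      ← lintegral_sub_right_eq_self ((Set.Iio (t - h)).indicator m) h]
    refine lintegral_congr fun r => ?_
    simp [Set.indicator]
  have hsplit : ∀ h, 0 ≤ h →
      (∫⁻ s in Set.Ici 0, if s < h then m (s + t - h) else 0) + F (t - h) = F t := by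
    intro h hh
    have h1 : (∫⁻ s in Set.Ici 0, if s < h then m (s + t - h) else 0)
        = ∫⁻ r in Set.Ico (t - h) t, m r := by
      rw [← lintegral_indicator measurableSet_Ici, ← lintegral_indicator measurableSet_Ico,
        ← lintegral_add_right_eq_self ((Set.Ico (t - h) t).indicator m) (t - h)]
      refine lintegral_congr fun s => ?_
      simp only [Set.indicator, Set.mem_Ici, Set.mem_Ico]
      by_cases h0 : 0 ≤ s
      · by_cases h2 : s < h
        · rw [if_pos h0, if_pos h2, if_pos ⟨by linarith, by linarith⟩]
          congr 1; ring
        · rw [if_pos h0, if_neg h2, if_neg (fun h3 => h2 (by linarith [h3.2]))]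
      · rw [if_neg h0, if_neg (fun h3 => h0 (by linarith [h3.1]))]
    rw [h1, add_comm, hF]
    simp only
    rw [← lintegral_union measurableSet_Ico, Set.Iio_union_Ico_eq_Iio (by linarith)]
    exact Set.disjoint_left.2 fun r h1 h2 => absurd h2.1 (not_le.2 h1)
  -- By `hsplit` the left side is the cycle mean of `F t - F (t - h)`, which `hFrenew` identifies.
  -- It replaces exactly the ages in `[0, t)` lost to the shift by `t`. Cancelling the mean of `F (t
  -- - h)` requires its finiteness, hence `hFt` and the boundedness of `f`.
  have hX : ∫⁻ s in Set.Ici 0, cycleIntegral (fun h => if s < h then m (s + t - h) else 0)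
      = ∫⁻ r in Set.Iio t, (Set.Ici 0).indicator (ageIntegral f) r := by
    have hk : Measurable (Function.uncurry fun s h => if s < h then m (s + t - h) else 0) :=
      Measurable.ite (measurableSet_lt measurable_fst measurable_snd)
        (hm.comp ((measurable_fst.add_const t).sub measurable_snd)) measurable_const
    have hfin : cycleIntegral (fun h => F (t - h)) ≠ ∞ := by
      refine ne_top_of_le_ne_top (ENNReal.mul_ne_top hC (ENNReal.ofReal_ne_top (r := t))) ?_
      rw [← cycleIntegral_const (C * ENNReal.ofReal t)]
      exact cycleIntegral_mono fun h hh => hFt _ (by linarith)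
    rw [lintegral_cycleIntegral hk]
    refine (ENNReal.add_left_inj hfin).1 ?_
    rw [← hFrenew, add_comm,
      ← cycleIntegral_add (by exact hFm.comp (measurable_const.sub measurable_id)),
      ← cycleIntegral_const (F t)]
    refine cycleIntegral_congr fun h hh => ?_
    rw [add_comm]
    exact hsplit h hh
  rw [lintegral_gaussianReal hg, lintegral_gaussianReal hf]
  congr 1
  calc ∫⁻ s in Set.Ici 0, ageIntegral (expect f t) s
      = ∫⁻ s in Set.Ici 0, (ageIntegral f (s + t)
          + cycleIntegral fun h => if s < h then m (s + t - h) else 0) := by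
        exact setLIntegral_congr_fun measurableSet_Ici fun s hs => ageIntegral_expect hf hs ht
    _ = (∫⁻ s in Set.Ici t, ageIntegral f s)
          + ∫⁻ r in Set.Iio t, (Set.Ici 0).indicator (ageIntegral f) r := by
        rw [lintegral_add_left (by exact hα.comp (measurable_id.add_const t)), hX]
        congr 1
        rw [← lintegral_indicator measurableSet_Ici, ← lintegral_indicator measurableSet_Ici,
          ← lintegral_add_right_eq_self ((Set.Ici t).indicator (ageIntegral f)) t]
        refine lintegral_congr fun r => ?_
        simp [Set.indicator]
    _ = ∫⁻ s in Set.Ici 0, ageIntegral f s := by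
        rw [setLIntegral_indicator measurableSet_Ici, Set.Ici_inter_Iio, add_comm,
          ← lintegral_union measurableSet_Ici, Set.Ico_union_Ici_eq_Ici ht]
        exact Set.disjoint_left.2 fun r h1 h2 => absurd h2 (not_le.2 h1.2)

theorem invariant_transition (t : ℝ≥0) : Kernel.Invariant (transition t) (gaussianReal 0 1) := by
  refine Measure.ext fun A hA => ?_
  have hf : Measurable (A.indicator (1 : ℝ → ℝ≥0∞)) := measurable_one.indicator hA
  have h := lintegral_expect_gaussianReal hf ENNReal.one_ne_top
    (fun x => Set.indicator_le_self' (by simp) x) t.coe_nonneg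
  simp only [expect_coe, lintegral_indicator_one hA] at h
  rw [Measure.bind_apply hA (transition t).measurable.aemeasurable, h]

/-! ### The drift condition. -/

/-- The Lyapunov function `exp |x|`. -/
noncomputable def lyapunov (x : ℝ) : ℝ≥0∞ := ENNReal.ofReal (Real.exp |x|)

theorem measurable_lyapunov : Measurable lyapunov := by
  unfold lyapunov
  fun_prop

theorem lintegral_lyapunov_rayleigh_lt_top : ∫⁻ y, lyapunov y ∂rayleigh < ∞ := by
  rw [rayleigh, lintegral_withDensity_eq_lintegral_mul _ measurable_rayleigh_density
    measurable_lyapunov]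
  have hint := (integrable_exp_neg_mul_sq (show (0 : ℝ) < 1 / 4 by norm_num)).const_mul
    (Real.exp 4)
  refine lt_of_le_of_lt (lintegral_mono fun y => ?_) hint.lintegral_lt_top
  rw [Pi.mul_apply, lyapunov]
  split_ifs with h
  · rw [← ENNReal.ofReal_mul (by positivity)]
    refine ENNReal.ofReal_le_ofReal ?_
    rw [abs_of_pos h]
    have h1 : y ≤ Real.exp y := by linarith [Real.add_one_le_exp y]
    calc y * Real.exp (-y ^ 2 / 2) * Real.exp y
        ≤ Real.exp y * Real.exp (-y ^ 2 / 2) * Real.exp y := by gcongr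
      _ = Real.exp (y + -y ^ 2 / 2 + y) := by rw [← Real.exp_add, ← Real.exp_add]
      _ ≤ Real.exp (4 + -(1 / 4) * y ^ 2) :=
          Real.exp_le_exp.2 (by nlinarith [sq_nonneg (y - 4)])
      _ = _ := by rw [Real.exp_add]
  · simp

/-- Below `-1` the drift shortens `|x|` by one. On `(-1, 0]` the value stays bounded. For `x > 0`
the unit-time hazard `x + 1/2` offsets the exponent `x + 1`. -/
theorem survival_mul_lyapunov_le (x : ℝ) :
    survival x 1 * lyapunov (x + 1)
      ≤ ENNReal.ofReal (Real.exp (-1)) * lyapunov x + ENNReal.ofReal (Real.exp 1) := by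
  rw [survival, lyapunov, lyapunov, ← ENNReal.ofReal_mul (Real.exp_pos _).le,
    ← ENNReal.ofReal_mul (Real.exp_pos _).le, ← Real.exp_add, ← Real.exp_add]
  have hz : 0 ≤ hazard x 1 := hazard_nonneg zero_le_one
  rcases le_or_gt x (-1) with h | h
  · refine le_add_right (ENNReal.ofReal_le_ofReal (Real.exp_le_exp.2 ?_))
    rw [abs_of_nonpos (by linarith), abs_of_nonpos (by linarith)]
    linarith
  · refine le_add_left (ENNReal.ofReal_le_ofReal (Real.exp_le_exp.2 ?_))
    rw [abs_of_nonneg (by linarith)]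
    rcases le_or_gt x 0 with h0 | h0
    · linarith
    · rw [hazard, rate_of_nonneg h0.le, rate_of_nonneg (by linarith)]
      nlinarith

theorem ageIntegral_lyapunov_le {t : ℝ} (ht : 0 ≤ t) (ht1 : t ≤ 1) :
    ageIntegral lyapunov t ≤ ENNReal.ofReal (Real.exp 1) * ∫⁻ y, lyapunov y ∂rayleigh := by
  rw [ageIntegral, ← lintegral_const_mul' _ _ ENNReal.ofReal_ne_top]
  refine lintegral_mono fun y => ?_
  calc survival (-y) t * lyapunov (-y + t) ≤ 1 * lyapunov (-y + t) := by
        gcongr; exact survival_le_one ht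
    _ ≤ _ := by
        rw [one_mul, lyapunov, lyapunov, ← ENNReal.ofReal_mul (Real.exp_pos _).le, ← Real.exp_add]
        refine ENNReal.ofReal_le_ofReal (Real.exp_le_exp.2 ?_)
        refine (abs_add_le _ _).trans ?_
        rw [abs_neg, abs_of_nonneg ht]
        linarith

theorem ageIntegral_mono {f g : ℝ → ℝ≥0∞} (h : ∀ x, f x ≤ g x) (t : ℝ) :
    ageIntegral f t ≤ ageIntegral g t :=
  lintegral_mono fun _ => mul_le_mul' le_rfl (h _)

/-- The no-jump part contracts by `survival_mul_lyapunov_le`; after a jump the start is forgotten,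
and the renewal bound on `[0, 1]` gives a constant. -/
theorem exists_drift_one : ∃ K : ℝ≥0∞, K ≠ ∞ ∧ ∀ x, ∫⁻ z, lyapunov z ∂(transition 1 x)
    ≤ ENNReal.ofReal (Real.exp (-1)) * lyapunov x + K := by
  set A := ENNReal.ofReal (Real.exp 1) * ∫⁻ y, lyapunov y ∂rayleigh with hA
  set K₀ := ENNReal.ofReal (Real.exp 1) * (A / (1 - rayleighLaplace)) with hK₀
  have hAtop : A ≠ ∞ :=
    ENNReal.mul_ne_top ENNReal.ofReal_ne_top lintegral_lyapunov_rayleigh_lt_top.ne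
  have hK₀top : K₀ ≠ ∞ := ENNReal.mul_ne_top ENNReal.ofReal_ne_top
    (ENNReal.div_ne_top hAtop (tsub_pos_of_lt rayleighLaplace_lt_one).ne')
  refine ⟨ENNReal.ofReal (Real.exp 1) + K₀, ENNReal.add_ne_top.2 ⟨ENNReal.ofReal_ne_top, hK₀top⟩,
    fun x => ?_⟩
  -- `renewal_bound` needs a bounded function, but its estimate does not depend on the truncation
  -- level; monotone convergence then removes the truncation.
  set f : ℕ → ℝ → ℝ≥0∞ := fun n z => min (lyapunov z) n with hf
  have hfm : ∀ n, Measurable (f n) := fun n => measurable_lyapunov.min measurable_const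
  have hfl : ∀ n z, f n z ≤ lyapunov z := fun n z => min_le_left _ _
  have hpost : ∀ n t, t ≤ 1 → postJump (f n) t ≤ K₀ := by
    intro n t ht
    have hC : ((n : ℝ≥0∞)) ≠ ∞ := ENNReal.natCast_ne_top n
    refine (renewal_bound (A := A) (T := 1) hC (postJump_le fun z => min_le_right _ _)
      (fun t ht => postJump_of_neg ht) (fun t ht ht1 => ?_) ht).trans ?_
    · rw [postJump_eq (hfm n) ht]
      exact add_le_add ((ageIntegral_mono (hfl n) t).trans (ageIntegral_lyapunov_le ht ht1)) le_rfl
    · rw [hK₀]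
      gcongr
  have hn : ∀ n, ∫⁻ z, f n z ∂(transition 1 x)
      ≤ ENNReal.ofReal (Real.exp (-1)) * lyapunov x + (ENNReal.ofReal (Real.exp 1) + K₀) := by
    intro n
    rw [← expect_coe, NNReal.coe_one, expect_eq (hfm n) zero_le_one, ← add_assoc]
    refine add_le_add (le_trans (mul_le_mul' le_rfl (hfl n _)) (survival_mul_lyapunov_le x)) ?_
    calc ∫⁻ e, postJump (f n) (1 - holdingTime x e) ∂(expMeasure 1)
        ≤ ∫⁻ _, K₀ ∂(expMeasure 1) :=
          lintegral_mono fun e => hpost n _ (by linarith [holdingTime_nonneg x e])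
      _ = K₀ := by simp
  have hsup : ∀ z, lyapunov z = ⨆ n, f n z := by
    intro z
    refine le_antisymm ?_ (iSup_le fun n => hfl n z)
    obtain ⟨n, hn⟩ := ENNReal.exists_nat_gt (r := lyapunov z) ENNReal.ofReal_ne_top
    exact le_iSup_of_le n (le_min le_rfl hn.le)
  simp_rw [hsup]
  rw [lintegral_iSup hfm fun i j hij z => min_le_min le_rfl (by exact_mod_cast hij)]
  simp_rw [← hsup]
  exact iSup_le hn

theorem exp_neg_one_le : ENNReal.ofReal (Real.exp (-1)) ≤ 2⁻¹ := by
  rw [← ENNReal.ofReal_ofNat 2, ← ENNReal.ofReal_inv_of_pos two_pos]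
  refine ENNReal.ofReal_le_ofReal ?_
  rw [Real.exp_neg]
  exact inv_anti₀ two_pos (by linarith [Real.add_one_le_exp (1 : ℝ)])

/-- Iteration of the one-step drift, whose constants sum to at most `2 * K`. Uniformity in `n`
matters because the minorization time is chosen after the constant. -/
theorem exists_drift : ∃ K : ℝ≥0∞, K ≠ ∞ ∧ ∀ (n : ℕ) (x : ℝ),
    ∫⁻ z, lyapunov z ∂(transition (n + 1) x) ≤ 2⁻¹ * lyapunov x + K := by
  obtain ⟨K, hK, h⟩ := exists_drift_one
  refine ⟨2 * K, ENNReal.mul_ne_top (by simp) hK, fun n => ?_⟩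
  have h1 : ∀ x, ∫⁻ z, lyapunov z ∂(transition 1 x) ≤ 2⁻¹ * lyapunov x + K := fun x =>
    (h x).trans (add_le_add (mul_le_mul' exp_neg_one_le le_rfl) le_rfl)
  induction n with
  | zero =>
    intro x
    rw [Nat.cast_zero, zero_add]
    exact (h1 x).trans (add_le_add le_rfl (by rw [two_mul]; exact le_self_add))
  | succ n ih =>
    intro x
    rw [transition_add, Kernel.lintegral_comp _ _ _ measurable_lyapunov]
    push_cast
    calc ∫⁻ z, ∫⁻ w, lyapunov w ∂(transition 1 z) ∂(transition (n + 1) x)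
        ≤ ∫⁻ z, (2⁻¹ * lyapunov z + K) ∂(transition (n + 1) x) := lintegral_mono h1
      _ = 2⁻¹ * ∫⁻ z, lyapunov z ∂(transition (n + 1) x) + K := by
          rw [lintegral_add_right _ measurable_const, lintegral_const_mul _ measurable_lyapunov]
          simp
      _ ≤ 2⁻¹ * (2⁻¹ * lyapunov x + 2 * K) + K := by gcongr; exact ih x
      _ = 2⁻¹ * (2⁻¹ * lyapunov x) + 2 * K := by
          rw [mul_add, ← mul_assoc 2⁻¹ 2 K, ENNReal.inv_mul_cancel (by simp) (by simp), one_mul,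
            add_assoc, two_mul]
      _ ≤ _ := by
          gcongr
          exact (mul_le_mul' (ENNReal.inv_le_one.2 one_le_two) le_rfl).trans (one_mul _).le

/-! ### The minorization condition. -/

/-- A fresh cycle puts mass on every subset of `[-2, -1]`, uniformly up to time `1`. -/
theorem le_ageIntegral {f : ℝ → ℝ≥0∞} {s : ℝ} (hs : 0 ≤ s) (hs1 : s ≤ 1) (hf : Measurable f) :
    ENNReal.ofReal (Real.exp (-9 / 2)) * ∫⁻ w in Set.Icc (-2) (-1), f w ≤ ageIntegral f s := by
  have hm : Measurable fun y => survival (-y) s * f (-y + s) :=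
    (measurable_survival.comp (measurable_neg.prodMk measurable_const)).mul
      (hf.comp (measurable_neg.add_const s))
  rw [ageIntegral, rayleigh, lintegral_withDensity_eq_lintegral_mul _ measurable_rayleigh_density
    hm, ← lintegral_const_mul' _ _ ENNReal.ofReal_ne_top,
    ← lintegral_indicator measurableSet_Icc]
  refine le_of_le_of_eq ?_ (lintegral_sub_left_eq_self _ s)
  refine lintegral_mono fun w => ?_
  by_cases hw : w ∈ Set.Icc (-2 : ℝ) (-1)
  · rw [Set.indicator_of_mem hw]
    have hpos : 0 < s - w := by linarith [hw.2]
    simp only [Pi.mul_apply, if_pos hpos]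
    -- The path from `w - s` to `w ≤ -1` stays where the rate is zero. Since `s - w` lies in `[1,
    -- 3]`, the Rayleigh density at the starting point is at least `exp (-9 / 2)`.
    have h1 : survival (-(s - w)) s = 1 := by
      rw [survival, hazard, rate_of_nonpos (by linarith [hw.2]),
        rate_of_nonpos (by linarith [hw.2])]
      simp
    rw [h1, one_mul, show -(s - w) + s = w by ring]
    gcongr
    have h3 : Real.exp (-9 / 2) ≤ Real.exp (-(s - w) ^ 2 / 2) :=
      Real.exp_le_exp.2 (by nlinarith [hw.1, hw.2])
    nlinarith [Real.exp_pos (-9 / 2), hw.1, hw.2]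
  · rw [Set.indicator_of_notMem hw]
    exact zero_le

theorem measure_lt_holdingTime (x : ℝ) {t : ℝ} (ht : 0 ≤ t) :
    expMeasure 1 {e | t < holdingTime x e} = survival x t := by
  have h := lintegral_holdingTime_sub x ht (g := fun _ => 1) measurable_const
  have hm : MeasurableSet {e | t < holdingTime x e} :=
    measurableSet_lt measurable_const (measurable_holdingTime_right x)
  simp only [lintegral_one, measure_univ, mul_one] at h
  rw [← h, ← lintegral_indicator_one hm]
  rfl

/-- The first jump falls in `(T - 1, T]` with probability bounded below, leaving less than one unit
of time for the fresh cycle, as `le_ageIntegral` allows. Without a jump, the position at `T - 1`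
lies in `[1, 2 * R + 1]`: the upper end bounds survival up to `T - 1` from below, the lower end
makes a jump within the next unit at least as likely as not. -/
theorem exists_minorization {R : ℝ≥0} {T : ℝ≥0} (hT : (T : ℝ) = R + 2) :
    ∃ c : ℝ≥0, c ≠ 0 ∧ ∀ x : ℝ, |x| ≤ R →
      c • (volume.restrict (Set.Icc (-2 : ℝ) (-1))) ≤ transition T x := by
  set p : ℝ≥0∞ := ENNReal.ofReal (Real.exp (-(2 * R + 1) ^ 2 / 2)) * 2⁻¹ with hp
  set q : ℝ≥0∞ := ENNReal.ofReal (Real.exp (-9 / 2)) with hq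
  have hR := R.coe_nonneg
  have hpq : p * q ≠ ∞ := by
    refine ENNReal.mul_ne_top (ENNReal.mul_ne_top ENNReal.ofReal_ne_top ?_) ENNReal.ofReal_ne_top
    simp
  have hpq0 : p * q ≠ 0 := by
    have h1 := Real.exp_pos (-(2 * (R : ℝ) + 1) ^ 2 / 2)
    have h2 := Real.exp_pos (-9 / 2)
    refine mul_ne_zero (mul_ne_zero ?_ (by simp)) ?_
    · exact (ENNReal.ofReal_pos.2 h1).ne'
    · exact (ENNReal.ofReal_pos.2 h2).ne'
  refine ⟨(p * q).toNNReal, (ENNReal.toNNReal_ne_zero).2 ⟨hpq0, hpq⟩, fun x hx => ?_⟩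
  obtain ⟨hx1, hx2⟩ := abs_le.1 hx
  refine Measure.le_iff.2 fun A hA => ?_
  have hf : Measurable (A.indicator (1 : ℝ → ℝ≥0∞)) := measurable_one.indicator hA
  have hprob : p ≤ expMeasure 1 {e | (T : ℝ) - 1 < holdingTime x e ∧ holdingTime x e ≤ T} := by
    have h1 := measure_lt_holdingTime x (t := T - 1) (by linarith)
    have h2 := measure_lt_holdingTime x (t := T) (by linarith)
    have hset : {e | (T : ℝ) - 1 < holdingTime x e ∧ holdingTime x e ≤ T}
        = {e | (T : ℝ) - 1 < holdingTime x e} \ {e | (T : ℝ) < holdingTime x e} := by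
      ext e; simp
    have hm : MeasurableSet {e | (T : ℝ) < holdingTime x e} :=
      measurableSet_lt measurable_const (measurable_holdingTime_right x)
    have hsub : {e | (T : ℝ) < holdingTime x e} ⊆ {e | (T : ℝ) - 1 < holdingTime x e} := by
      intro e he
      simp only [Set.mem_ofPred_eq] at he ⊢
      linarith
    rw [hset, measure_sdiff hsub hm.nullMeasurableSet (measure_ne_top _ _), h1, h2]
    have h3 : survival x T = survival x (T - 1) * survival (x + (T - 1)) 1 := by
      rw [← survival_add]; ring_nf
    have hz : 1 ≤ x + (T - 1) := by linarith
    have h4 : survival (x + (T - 1)) 1 ≤ 2⁻¹ := by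
      refine le_trans (ENNReal.ofReal_le_ofReal (Real.exp_le_exp.2 ?_)) exp_neg_one_le
      rw [hazard, rate_of_nonneg (by linarith), rate_of_nonneg (by linarith)]
      nlinarith
    have h5 : ENNReal.ofReal (Real.exp (-(2 * R + 1) ^ 2 / 2)) ≤ survival x (T - 1) := by
      refine ENNReal.ofReal_le_ofReal (Real.exp_le_exp.2 ?_)
      rw [hazard, rate_of_nonneg (by linarith : 0 ≤ x + (T - 1))]
      nlinarith [sq_nonneg (rate x)]
    have h6 : survival x (T - 1) ≠ ∞ := ENNReal.ofReal_ne_top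
    rw [h3, hp]
    refine (mul_le_mul' h5 le_rfl).trans ?_
    refine ENNReal.le_sub_of_add_le_right (ENNReal.mul_ne_top h6 ENNReal.ofReal_ne_top) ?_
    rw [← mul_add]
    refine (mul_le_mul' le_rfl (add_le_add le_rfl h4)).trans ?_
    rw [ENNReal.inv_two_add_inv_two, mul_one]
  have hI : ∫⁻ w in Set.Icc (-2 : ℝ) (-1), A.indicator (1 : ℝ → ℝ≥0∞) w
      = volume.restrict (Set.Icc (-2 : ℝ) (-1)) A := lintegral_indicator_one hA
  have hm : MeasurableSet {e | (T : ℝ) - 1 < holdingTime x e ∧ holdingTime x e ≤ T} :=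
    (measurableSet_lt measurable_const (measurable_holdingTime_right x)).inter
      (measurableSet_le (measurable_holdingTime_right x) measurable_const)
  calc ((p * q).toNNReal • volume.restrict (Set.Icc (-2 : ℝ) (-1))) A
      = (q * volume.restrict (Set.Icc (-2 : ℝ) (-1)) A) * p := by
        rw [Measure.smul_apply, ENNReal.smul_def, ENNReal.coe_toNNReal hpq, smul_eq_mul]
        ring
    _ ≤ (q * volume.restrict (Set.Icc (-2 : ℝ) (-1)) A) *
          expMeasure 1 {e | (T : ℝ) - 1 < holdingTime x e ∧ holdingTime x e ≤ T} := by gcongr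
    _ = ∫⁻ e, {e | (T : ℝ) - 1 < holdingTime x e ∧ holdingTime x e ≤ T}.indicator
          (fun _ => q * volume.restrict (Set.Icc (-2 : ℝ) (-1)) A) e ∂(expMeasure 1) :=
        (lintegral_indicator_const hm _).symm
    _ ≤ ∫⁻ e, postJump (A.indicator 1) (T - holdingTime x e) ∂(expMeasure 1) := by
        refine lintegral_mono fun e => ?_
        refine Set.indicator_le' (fun e he => ?_) (fun e _ => (zero_le : 0 ≤ postJump (A.indicator 1) (T - holdingTime x e))) e
        rw [postJump_eq hf (by linarith [he.2]), ← hI]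
        exact (le_ageIntegral (by linarith [he.2]) (by linarith [he.1]) hf).trans le_self_add
    _ ≤ expect (A.indicator 1) T x := by
        rw [expect_eq hf T.coe_nonneg]
        exact le_add_self
    _ = transition T x A := by rw [expect_coe, lintegral_indicator_one hA]

/-! ### Harris' theorem. -/

/-- A function with bounded weighted oscillation is close to a constant in weighted norm. -/
theorem exists_const_of_weighted_oscillation {α : Type*} [Nonempty α] {φ w : α → ℝ} {B : ℝ}
    (hφB : ∀ x, |φ x| ≤ B) (hw : ∀ x, 0 ≤ w x) (h : ∀ x y, |φ x - φ y| ≤ w x + w y) :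
    ∃ c, ∀ x, |φ x - c| ≤ w x := by
  have hbdd : BddBelow (Set.range fun x => φ x + w x) :=
    ⟨-B, by rintro _ ⟨x, rfl⟩; linarith [(abs_le.1 (hφB x)).1, hw x]⟩
  -- Any `c` between `sup (φ - w)` and `inf (φ + w)` would do; the oscillation hypothesis says
  -- exactly that the former is at most the latter.
  refine ⟨⨅ x, φ x + w x, fun y => abs_le.2 ⟨?_, ?_⟩⟩
  · have := ciInf_le hbdd y
    linarith
  · have : φ y - w y ≤ ⨅ x, φ x + w x :=
      le_ciInf fun x => by linarith [(abs_le.1 (h y x)).2]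
    linarith

/-- The contraction step of Harris' theorem for a function of bounded weighted oscillation. -/
theorem harris_contraction {α : Type*} [MeasurableSpace α] [Nonempty α] (P : Kernel α α)
    [IsMarkovKernel P] {V : α → ℝ} (hVm : Measurable V) (hV : ∀ x, 0 ≤ V x) {K : ℝ} (hK : 0 ≤ K)
    (hdrift : ∀ x, ∫⁻ z, ENNReal.ofReal (V z) ∂(P x) ≤ ENNReal.ofReal (V x / 2 + K))
    {ν : Measure α} (hν : ν ≠ 0)
    (hminor : ∀ x, V x ≤ 4 * K + 4 → ν ≤ P x) (hne : ∃ x, V x ≤ 4 * K + 4) :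
    ∃ β ρ : ℝ, 0 < β ∧ 0 < ρ ∧ ρ < 1 ∧ ∀ (φ : α → ℝ) (B C : ℝ), Measurable φ → (∀ x, |φ x| ≤ B) →
      0 ≤ C → (∀ x y, |φ x - φ y| ≤ C * (2 + β * V x + β * V y)) →
      ∀ x y, |∫ z, φ z ∂(P x) - ∫ z, φ z ∂(P y)| ≤ ρ * C * (2 + β * V x + β * V y) := by
  obtain ⟨x₀, hx₀⟩ := hne
  have hν1 : ν Set.univ ≤ 1 := (hminor x₀ hx₀ Set.univ).trans_eq measure_univ
  have : IsFiniteMeasure ν := ⟨hν1.trans_lt ENNReal.one_lt_top⟩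
  set ε : ℝ := ν.real Set.univ with hε
  have hε0 : 0 < ε := by
    rw [hε, measureReal_def]
    exact ENNReal.toReal_pos (by rwa [ne_eq, Measure.measure_univ_eq_zero]) (measure_ne_top _ _)
  have hε1 : ε ≤ 1 := ENNReal.toReal_le_of_le_ofReal zero_le_one (by simpa using hν1)
  -- Small enough that the drift constant costs `2 * β * K ≤ ε`, half of the gain `2 * ε` from the
  -- minorization.
  set β : ℝ := ε / (2 * K + 1) with hβ
  have hβ0 : 0 < β := by positivity
  have hβK : 2 * β * K ≤ ε := by
    rw [hβ]
    have : 2 * (ε / (2 * K + 1)) * K = ε * (2 * K / (2 * K + 1)) := by field_simp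
    rw [this]
    refine mul_le_of_le_one_right hε0.le ?_
    rw [div_le_one (by positivity)]
    linarith
  -- Chosen so that `(1 / 2 - δ) * R = 2 * K` for the level `R = 4 * K + 4`: above it, the drift
  -- still gains the fraction `δ` of `V x + V y`.
  set δ : ℝ := 1 / (2 * (K + 1)) with hδ
  have hδ0 : 0 < δ := by positivity
  set R : ℝ := 4 * K + 4 with hR
  have hR0 : 0 < R := by positivity
  set η : ℝ := min (ε / 2) (δ * (β * R) / (2 + β * R)) with hη
  have hη0 : 0 < η := lt_min (by positivity) (by positivity)
  have hη1 : η ≤ ε / 2 := min_le_left _ _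
  have hη2 : η * (2 + β * R) ≤ δ * (β * R) := by
    have : η ≤ δ * (β * R) / (2 + β * R) := min_le_right _ _
    rwa [le_div_iff₀ (by positivity)] at this
  refine ⟨β, 1 - η, hβ0, by linarith, by linarith, fun φ B C hφm hφB hC hosc x y => ?_⟩
  -- Centring turns the oscillation bound into a pointwise one, and subtracting a constant does not
  -- change the difference of the two probability integrals.
  obtain ⟨c, hc⟩ := exists_const_of_weighted_oscillation (w := fun x => C * (1 + β * V x)) hφB
    (fun x => by have := hV x; positivity) (fun x y => by
      have := hosc x y
      nlinarith)
  set ψ : α → ℝ := fun z => φ z - c with hψ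
  have hψm : Measurable ψ := hφm.sub_const c
  have hφint : ∀ (μ : Measure α) [IsFiniteMeasure μ], Integrable φ μ := fun μ _ =>
    Integrable.of_bound hφm.aestronglyMeasurable B (Filter.Eventually.of_forall fun z => hφB z)
  have hψint : ∀ (μ : Measure α) [IsFiniteMeasure μ], Integrable ψ μ := fun μ _ =>
    (hφint μ).sub (integrable_const c)
  have hVint : ∀ x, Integrable V (P x) := fun x => by
    refine ⟨hVm.aestronglyMeasurable, ?_⟩
    rw [hasFiniteIntegral_iff_ofReal (Filter.Eventually.of_forall hV)]
    exact (hdrift x).trans_lt ENNReal.ofReal_lt_top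
  have hVdrift : ∀ x, ∫ z, V z ∂(P x) ≤ V x / 2 + K := fun x => by
    rw [integral_eq_lintegral_of_nonneg_ae (Filter.Eventually.of_forall hV)
      hVm.aestronglyMeasurable]
    exact ENNReal.toReal_le_of_le_ofReal (by have := hV x; positivity) (hdrift x)
  have hbound : ∀ (μ : Measure α) [IsFiniteMeasure μ], Integrable V μ →
      |∫ z, ψ z ∂μ| ≤ C * (μ.real Set.univ + β * ∫ z, V z ∂μ) := by
    intro μ _ hμ
    calc |∫ z, ψ z ∂μ| ≤ ∫ z, |ψ z| ∂μ := abs_integral_le_integral_abs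
      _ ≤ ∫ z, C * (1 + β * V z) ∂μ :=
          integral_mono (hψint μ).abs
            (((integrable_const (1 : ℝ)).add (hμ.const_mul β)).const_mul C) hc
      _ = _ := by
          rw [integral_const_mul, integral_add (integrable_const _) (hμ.const_mul β),
            integral_const_mul]
          simp
  have hψeq : ∀ x, ∫ z, ψ z ∂(P x) = ∫ z, φ z ∂(P x) - c := fun x => by
    rw [hψ, integral_sub (hφint _) (integrable_const _)]
    simp
  have hdiff : ∫ z, φ z ∂(P x) - ∫ z, φ z ∂(P y) = ∫ z, ψ z ∂(P x) - ∫ z, ψ z ∂(P y) := by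
    rw [hψeq, hψeq]; ring
  rw [hdiff]
  have hVx := hV x
  have hVy := hV y
  set S : ℝ := V x + V y with hS
  have hgoal : ∀ r : ℝ, |∫ z, ψ z ∂(P x) - ∫ z, ψ z ∂(P y)| ≤ C * r →
      r ≤ (1 - η) * (2 + β * S) →
      |∫ z, ψ z ∂(P x) - ∫ z, ψ z ∂(P y)| ≤ (1 - η) * C * (2 + β * V x + β * V y) := by
    intro r h1 h2
    refine h1.trans ((mul_le_mul_of_nonneg_left h2 hC).trans_eq ?_)
    rw [hS]; ring
  -- For large `V x + V y` the drift alone contracts. Otherwise both points lie in the small set,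
  -- and the common part `ν` cancels in the difference.
  rcases le_or_gt R S with hRS | hRS
  · refine hgoal (2 + β * S / 2 + 2 * β * K) ?_ ?_
    · have h1 := hbound (P x) (hVint x)
      have h2 := hbound (P y) (hVint y)
      simp only [probReal_univ] at h1 h2
      have h3 : C * (1 + β * ∫ z, V z ∂(P x)) ≤ C * (1 + β * (V x / 2 + K)) := by
        gcongr; exact hVdrift x
      have h4 : C * (1 + β * ∫ z, V z ∂(P y)) ≤ C * (1 + β * (V y / 2 + K)) := by
        gcongr; exact hVdrift y
      have h5 := abs_sub (∫ z, ψ z ∂(P x)) (∫ z, ψ z ∂(P y))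
      have h6 : C * (1 + β * (V x / 2 + K)) + C * (1 + β * (V y / 2 + K))
          = C * (2 + β * S / 2 + 2 * β * K) := by rw [hS]; ring
      linarith
    · have hδK : 2 * K ≤ S / 2 - δ * S := by
        have h1 : δ * (2 * (K + 1)) = 1 := by rw [hδ]; field_simp
        have h2 : δ ≤ 1 / 2 := by
          rw [hδ]; exact one_div_le_one_div_of_le two_pos (by linarith)
        have h3 : (1 / 2 - δ) * R ≤ (1 / 2 - δ) * S :=
          mul_le_mul_of_nonneg_left hRS (by linarith)
        have h4 : (1 / 2 - δ) * R = 2 * K := by rw [hR]; linear_combination -2 * h1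
        linarith
      have h1 : 2 * β * K ≤ β * (S / 2) - β * (δ * S) := by
        have := mul_le_mul_of_nonneg_left hδK hβ0.le
        linarith
      have h2 : η * (2 + β * S) ≤ δ * (β * S) := by
        have hηδ : η ≤ δ := by
          by_contra! hcon
          have := mul_pos hβ0 hR0
          nlinarith
        have := mul_le_mul_of_nonneg_left (mul_le_mul_of_nonneg_left hRS hβ0.le)
          (sub_nonneg.2 hηδ)
        nlinarith
      nlinarith
  · refine hgoal (2 * (1 - ε) + β * S / 2 + 2 * β * K) ?_ ?_
    · have hsplit : ∀ x, V x ≤ R → ∃ Q : Measure α, IsFiniteMeasure Q ∧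
          ∫ z, ψ z ∂(P x) = ∫ z, ψ z ∂Q + ∫ z, ψ z ∂ν ∧
          |∫ z, ψ z ∂Q| ≤ C * (1 - ε + β * (V x / 2 + K)) := by
        intro x hx
        have hle := hminor x hx
        have hQ := Measure.sub_add_cancel_of_le hle
        set Q := P x - ν with hQdef
        have hQle : Q ≤ P x := Measure.sub_le
        have : IsFiniteMeasure Q := isFiniteMeasure_of_le _ hQle
        refine ⟨Q, inferInstance, ?_, ?_⟩
        · rw [← integral_add_measure (hψint Q) (hψint ν), hQ]
        · refine (hbound Q ((hVint x).mono_measure hQle)).trans ?_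
          have h1 : Q.real Set.univ = 1 - ε := by
            have : (Q + ν).real Set.univ = 1 := by rw [hQ]; simp
            rw [measureReal_add_apply] at this
            linarith
          have h2 : ∫ z, V z ∂Q ≤ ∫ z, V z ∂(P x) :=
            integral_mono_measure hQle (Filter.Eventually.of_forall hV) (hVint x)
          rw [h1]
          gcongr
          exact h2.trans (hVdrift x)
      obtain ⟨Q₁, _, h1, h1'⟩ := hsplit x (by linarith)
      obtain ⟨Q₂, _, h2, h2'⟩ := hsplit y (by linarith)
      rw [h1, h2, add_sub_add_right_eq_sub]
      refine (abs_sub _ _).trans ((add_le_add h1' h2').trans_eq ?_)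
      rw [hS]; ring
    · have : 0 ≤ β * S := by positivity
      nlinarith

/-! ### Total variation and exponential convergence. -/

/-- On a Hahn decomposition the total variation is the difference of the signed masses of the two
pieces, each at most `B` in absolute value. -/
theorem tvNorm_le {μ ν : Measure ℝ} [IsFiniteMeasure μ] [IsFiniteMeasure ν] {B : ℝ}
    (h : ∀ A, MeasurableSet A → |μ.real A - ν.real A| ≤ B) : tvNorm μ ν ≤ 2 * B := by
  rw [tvNorm, SignedMeasure.totalVariation]
  obtain ⟨i, hi₁, hi₂, hi₃, hpos, hneg⟩ :=
    (μ.toSignedMeasure - ν.toSignedMeasure).toJordanDecomposition_spec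
  rw [measureReal_add_apply, hpos, hneg,
    SignedMeasure.toMeasureOfZeroLE_real_apply _ hi₂ hi₁ MeasurableSet.univ,
    SignedMeasure.toMeasureOfLEZero_real_apply _ hi₃ hi₁.compl MeasurableSet.univ,
    Set.inter_univ, Set.inter_univ, Measure.toSignedMeasure_sub_apply hi₁,
    Measure.toSignedMeasure_sub_apply hi₁.compl]
  have h1 := (abs_le.1 (h i hi₁)).2
  have h2 := (abs_le.1 (h iᶜ hi₁.compl)).1
  linarith

theorem transition_add_real (s t : ℝ≥0) (x : ℝ) {A : Set ℝ} (hA : MeasurableSet A) :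
    (transition (s + t) x).real A = ∫ y, (transition t y).real A ∂(transition s x) := by
  have hm : Measurable fun y => transition t y A := Kernel.measurable_coe _ hA
  rw [measureReal_def, transition_add, Kernel.comp_apply' _ _ _ hA]
  exact (integral_toReal hm.aemeasurable
    (Filter.Eventually.of_forall fun y => measure_lt_top _ _)).symm

theorem gaussianReal_real_eq (t : ℝ≥0) {A : Set ℝ} (hA : MeasurableSet A) :
    (gaussianReal 0 1).real A = ∫ y, (transition t y).real A ∂(gaussianReal 0 1) := by
  have hm : Measurable fun y => transition t y A := Kernel.measurable_coe _ hA
  have h := invariant_transition t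
  rw [Kernel.Invariant] at h
  conv_lhs => rw [measureReal_def, ← h,
    Measure.bind_apply hA (transition t).measurable.aemeasurable]
  exact (integral_toReal hm.aemeasurable
    (Filter.Eventually.of_forall fun y => measure_lt_top _ _)).symm

theorem integrable_exp_abs_gaussianReal :
    Integrable (fun x : ℝ => Real.exp |x|) (gaussianReal 0 1) := by
  have h1 : Integrable (fun x : ℝ => Real.exp (1 * x) + Real.exp (-1 * x)) (gaussianReal 0 1) :=
    (integrable_exp_mul_gaussianReal 1).add (integrable_exp_mul_gaussianReal (-1))
  refine h1.mono (by fun_prop) (Filter.Eventually.of_forall fun x => ?_)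
  rw [Real.norm_of_nonneg (Real.exp_pos _).le, Real.norm_of_nonneg (by positivity)]
  rcases abs_cases x with ⟨h, _⟩ | ⟨h, _⟩ <;> rw [h]
  · rw [one_mul]; linarith [Real.exp_pos (-1 * x)]
  · rw [neg_one_mul]; linarith [Real.exp_pos (1 * x)]

/-- A geometric contraction of the semigroup along multiples of a fixed time. -/
theorem exists_geometric_contraction : ∃ (T : ℝ≥0) (β ρ : ℝ), 0 < T ∧ 0 < β ∧ 0 < ρ ∧ ρ < 1 ∧
    ∀ (A : Set ℝ), MeasurableSet A → ∀ (n : ℕ) (r : ℝ≥0) (x y : ℝ),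
      |(transition (n * T + r) x).real A - (transition (n * T + r) y).real A|
        ≤ ρ ^ n * (2 + β * Real.exp |x| + β * Real.exp |y|) := by
  obtain ⟨K, hKtop, hdrift⟩ := exists_drift
  set k : ℝ := K.toReal with hk
  have hk0 : 0 ≤ k := ENNReal.toReal_nonneg
  obtain ⟨N, hN⟩ := exists_nat_gt (Real.log (4 * k + 4))
  -- `N` is large enough that `exp |x| ≤ 4 * k + 4` forces `|x| ≤ N`. The time `N + 2` is written as
  -- a successor to fit `exists_drift`.
  obtain ⟨c, hc0, hc⟩ := exists_minorization (R := N) (T := ((N + 1 : ℕ) + 1 : ℝ≥0)) (by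
    push_cast; ring)
  set T : ℝ≥0 := ((N + 1 : ℕ) + 1 : ℝ≥0) with hT
  have hd : ∀ x, ∫⁻ z, ENNReal.ofReal (Real.exp |z|) ∂(transition T x)
      ≤ ENNReal.ofReal (Real.exp |x| / 2 + k) := by
    intro x
    refine (hdrift (N + 1) x).trans_eq ?_
    rw [ENNReal.ofReal_add (by positivity) hk0, hk, ENNReal.ofReal_toReal hKtop,
      ENNReal.ofReal_div_of_pos two_pos, ENNReal.ofReal_ofNat, ENNReal.div_eq_inv_mul]
    rfl
  have hν : c • (volume.restrict (Set.Icc (-2 : ℝ) (-1))) ≠ 0 := by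
    intro h
    have h1 := congrArg (fun μ : Measure ℝ => μ Set.univ) h
    simp only [Measure.smul_apply, Measure.restrict_apply_univ, Real.volume_Icc, ENNReal.smul_def,
      smul_eq_mul, Measure.coe_zero, Pi.zero_apply, mul_eq_zero, ENNReal.coe_eq_zero, hc0,
      false_or, ENNReal.ofReal_eq_zero] at h1
    norm_num at h1
  obtain ⟨β, ρ, hβ, hρ0, hρ1, hcontr⟩ := harris_contraction (transition T)
    (V := fun x => Real.exp |x|) (by fun_prop) (fun x => (Real.exp_pos _).le) hk0 hd hν
    (fun x hx => hc x (by
      have h1 : |x| ≤ Real.log (4 * k + 4) := (Real.le_log_iff_exp_le (by positivity)).2 hx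
      rw [NNReal.coe_natCast]
      linarith)) ⟨0, by simp; linarith⟩
  refine ⟨T, β, ρ, by positivity, hβ, hρ0, hρ1, fun A hA n r => ?_⟩
  have hle1 : ∀ t x, |(transition t x).real A| ≤ 1 := fun t x => by
    rw [abs_of_nonneg measureReal_nonneg]
    exact measureReal_le_one
  induction n with
  | zero =>
    intro x y
    have hx := Real.exp_pos |x|
    have hy := Real.exp_pos |y|
    refine (abs_sub _ _).trans ?_
    have := mul_pos hβ hx
    have := mul_pos hβ hy
    have h1 := hle1 ((0 : ℕ) * T + r) x
    have h2 := hle1 ((0 : ℕ) * T + r) y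
    rw [pow_zero, one_mul]
    linarith
  | succ n ih =>
    intro x y
    have hsplit : ((n + 1 : ℕ) * T + r : ℝ≥0) = T + (n * T + r) := by push_cast; ring
    rw [hsplit, transition_add_real _ _ _ hA, transition_add_real _ _ _ hA, pow_succ']
    -- One contraction step for `transition T`, applied to the bounded function `y ↦ transition (n *
    -- T + r) y A`, whose weighted oscillation is at most `ρ ^ n` by induction.
    exact hcontr _ 1 (ρ ^ n) (Kernel.measurable_coe _ hA).ennreal_toReal (hle1 _)
      (by positivity) ih x y

end RadialMomentum

theorem proposition3p5 :
    (∀ s t : ℝ≥0, RadialMomentum.transition (s + t)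
        = RadialMomentum.transition t ∘ₖ RadialMomentum.transition s) ∧
    (∀ t : ℝ≥0, Kernel.Invariant (RadialMomentum.transition t) (gaussianReal 0 1)) ∧
    ∃ V : ℝ → ℝ, Integrable V (gaussianReal 0 1) ∧
      ∃ c₁ c₂ : ℝ, 0 < c₁ ∧ 0 < c₂ ∧
        ∀ (t : ℝ≥0) (x : ℝ),
          RadialMomentum.tvNorm (RadialMomentum.transition t x) (gaussianReal 0 1)
            ≤ c₁ * Real.exp (-c₂ * t) * V x := by
  refine ⟨RadialMomentum.transition_add, RadialMomentum.invariant_transition, ?_⟩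
  obtain ⟨T, β, ρ, hT, hβ, hρ0, hρ1, hcontr⟩ := RadialMomentum.exists_geometric_contraction
  have hT' : (0 : ℝ) < T := hT
  have hint := RadialMomentum.integrable_exp_abs_gaussianReal
  set G : ℝ := ∫ y, Real.exp |y| ∂(gaussianReal 0 1) with hG
  have hG0 : 0 ≤ G := integral_nonneg fun y => (Real.exp_pos _).le
  have hlog : Real.log ρ < 0 := Real.log_neg hρ0 hρ1
  refine ⟨fun x => 2 * (2 + β * Real.exp |x| + β * G),
    ((((integrable_const _).add (hint.const_mul β)).add (integrable_const _)).const_mul 2),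
    ρ⁻¹, -Real.log ρ / T, by positivity, div_pos (by linarith) hT', fun t x => ?_⟩
  -- Rounding `t / T` down loses less than one contraction step, which accounts for `c₁ = ρ⁻¹`.
  set n : ℕ := ⌊(t / T : ℝ≥0)⌋₊ with hn
  have hnT : (n : ℝ≥0) * T ≤ t := by
    have := Nat.floor_le (zero_le : 0 ≤ (t / T : ℝ≥0))
    rwa [← hn, le_div_iff₀ hT] at this
  have ht : t = n * T + (t - n * T) := (add_tsub_cancel_of_le hnT).symm
  have hpow : ρ ^ n ≤ ρ⁻¹ * Real.exp (-(-Real.log ρ / T) * t) := by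
    have h1 : (t : ℝ) / T - 1 ≤ n := by
      have := Nat.lt_floor_add_one (t / T : ℝ≥0)
      rw [← hn] at this
      have h2 : (t : ℝ) / T < n + 1 := by exact_mod_cast this
      linarith
    calc ρ ^ n = Real.exp (Real.log ρ * n) := by
          rw [← Real.rpow_natCast, Real.rpow_def_of_pos hρ0]
      _ ≤ Real.exp (Real.log ρ * (t / T - 1)) :=
          Real.exp_le_exp.2 (mul_le_mul_of_nonpos_left h1 hlog.le)
      _ = Real.exp (-Real.log ρ) * Real.exp (-(-Real.log ρ / T) * t) := by
          rw [← Real.exp_add]; congr 1; ring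
      _ = _ := by rw [Real.exp_neg, Real.exp_log hρ0]
  have hset : ∀ A, MeasurableSet A → |(RadialMomentum.transition t x).real A
      - (gaussianReal 0 1).real A| ≤ ρ ^ n * (2 + β * Real.exp |x| + β * G) := by
    intro A hA
    have hm : Measurable fun y => (RadialMomentum.transition t y).real A :=
      (Kernel.measurable_coe _ hA).ennreal_toReal
    have hi : Integrable (fun y => (RadialMomentum.transition t y).real A) (gaussianReal 0 1) :=
      Integrable.of_bound hm.aestronglyMeasurable 1 (Filter.Eventually.of_forall fun y => by
        rw [Real.norm_of_nonneg measureReal_nonneg]; exact measureReal_le_one)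
    -- Invariance rewrites `γ A` as the `γ`-mean of `transition t y A`, so the two-point contraction
    -- can be averaged over `y`; this is where `G` enters `V`.
    have h1 : (RadialMomentum.transition t x).real A - (gaussianReal 0 1).real A
        = ∫ y, ((RadialMomentum.transition t x).real A
          - (RadialMomentum.transition t y).real A) ∂(gaussianReal 0 1) := by
      rw [integral_sub (integrable_const _) hi, ← RadialMomentum.gaussianReal_real_eq t hA]
      simp
    have hV : Integrable (fun y => ρ ^ n * (2 + β * Real.exp |x| + β * Real.exp |y|))
        (gaussianReal 0 1) :=
      ((integrable_const _).add (hint.const_mul β)).const_mul _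
    rw [h1]
    calc _ ≤ ∫ y, |(RadialMomentum.transition t x).real A
          - (RadialMomentum.transition t y).real A| ∂(gaussianReal 0 1) :=
          abs_integral_le_integral_abs
      _ ≤ ∫ y, ρ ^ n * (2 + β * Real.exp |x| + β * Real.exp |y|) ∂(gaussianReal 0 1) := by
          refine integral_mono ((integrable_const _).sub hi).abs hV fun y => ?_
          have := hcontr A hA n (t - n * T) x y
          rwa [← ht] at this
      _ = _ := by
          rw [integral_const_mul, integral_add (integrable_const _) (hint.const_mul β),
            integral_const_mul]
          simp [hG]
  have hx := Real.exp_pos |x|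
  calc _ ≤ 2 * (ρ ^ n * (2 + β * Real.exp |x| + β * G)) := RadialMomentum.tvNorm_le hset
    _ = ρ ^ n * (2 * (2 + β * Real.exp |x| + β * G)) := by ring
    _ ≤ _ := mul_le_mul_of_nonneg_right hpow (by positivity)
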